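/- Let PV be a first-order language with equality that has only function symbols, with a standard interpretation in $\mathbb{N}$ such that every symbol denotes a polynomial-time computable function $\mathbb{N}^k\to\mathbb{N}$ (numbers being written in binary) and every such function is denoted by a symbol; for example, PV may have exactly one function symbol for each polynomial-time clocked Turing machine. Let $T_{\mathrm{PV}}$ be the theory axiomatized by all universal PV-sentences that are true in $\mathbb{N}$. Let $\textsc{PrimeFactor}$ be the PV-sentence $$(\forall x\ge 2)(\exists y\le x)(\forall z\le y)\bigl(2\le y\ \wedge\ y\mid x\ \wedge\ (z\mid y\to (z=1\vee z=y))\bigr),$$ where $1$ and $2$ are PV-constants with these values, and $a\le b$ and $a\mid b$ stand for $g(a,b)=1$ with PV-symbols $g$ whose standard interpretation takes the value $1$ exactly when $a\le b$, respectively when $a$ divides $b$. For $n\in\mathbb{N}$ let $P_n$ be the set of all primes of binary length $n$. Assume that for every real $r>0$ and every sequence $\{C_n\}_{n\in\mathbb{N}}$ of Boolean circuits of size polynomial in $n$, where $C_n$ has $2n$ inputs and $n$ outputs and acts on numbers through their binary digits, there is an $n$ with $P_n\neq\emptyset$ such that $$\Pr_{p,q\sim P_n}\bigl[C_n(pq)\in\{p,q\}\bigr]<r,$$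 where $p,q$ are sampled uniformly and independently from $P_n$. Then $T_{\mathrm{PV}}\nvdash\textsc{PrimeFactor}$. Consequently, no theory in the language PV all of whose axioms are provable in $T_{\mathrm{PV}}$ (in particular, not $\mathrm{PV}_1$) proves $\textsc{PrimeFactor}$. -/

import Mathlib

open FirstOrder

universe u v

namespace PVFactor

/-! ### Polynomial-time functions on numbers -/

/-- The word presenting a tuple of numbers to a machine: the binary expansions of the entries, each
followed by the separator `none`. -/
def encodeArgs {k : ℕ} (v : Fin k → ℕ) : List (Option Bool) :=
  (List.ofFn v).flatMap fun a => (Computability.encodeNat a).map some ++ [none]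

/-- A clocked polynomial-time Turing machine computing `g : ℕ^k → ℕ`: a machine, a polynomial
bounding its number of steps in the length of the input word, and the fact that on every input it
halts within that bound with the binary expansion of the value as its output. -/
abbrev ClockedMachine {k : ℕ} (g : (Fin k → ℕ) → ℕ) : Type 1 :=
  Turing.TM2ComputableInPolyTime encodeArgs Computability.encodeNat g

/-- `g` is computable in polynomial time (in the binary lengths of its arguments). -/
def PolyTime {k : ℕ} (g : (Fin k → ℕ) → ℕ) : Prop := Nonempty (ClockedMachine g)

/-! ### The language PV and the true universal theory -/

/-- `L`, with the given standard interpretation in `ℕ`, is a language PV: besides equality it has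
only function symbols, every one of them denotes a polynomial-time function, and every
polynomial-time function is denoted by some symbol. -/
structure IsPV (L : FirstOrder.Language.{u, v}) [L.Structure ℕ] : Prop where
  algebraic : L.IsAlgebraic
  polyTime : ∀ (k : ℕ) (f : L.Functions k),
    PolyTime fun a : Fin k → ℕ => FirstOrder.Language.Structure.funMap f a
  exists_symbol : ∀ (k : ℕ) (g : (Fin k → ℕ) → ℕ), PolyTime g →
    ∃ f : L.Functions k, ∀ a : Fin k → ℕ, FirstOrder.Language.Structure.funMap f a = g a

/-- The minimal language PV: one `k`-ary function symbol for every clocked polynomial-time machine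
with `k` arguments, and nothing else. -/
def machineLanguage : FirstOrder.Language.{1, 0} where
  Functions k := Σ g : (Fin k → ℕ) → ℕ, ClockedMachine g
  Relations _ := Empty

/-- Each symbol is interpreted by the function that its machine computes. -/
instance : machineLanguage.Structure ℕ where
  funMap f a := f.1 a
  RelMap r _ := r.elim

theorem isPV_machineLanguage : IsPV machineLanguage where
  algebraic _ := inferInstanceAs (IsEmpty Empty)
  polyTime _ f := ⟨f.2⟩
  exists_symbol _ g := fun ⟨M⟩ => ⟨⟨g, M⟩, fun _ => rfl⟩

/-- `T_PV`: the set of all universal sentences of the language that are true in `ℕ`. -/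
def TPV (L : FirstOrder.Language.{u, v}) [L.Structure ℕ] : L.Theory :=
  {φ | φ.IsUniversal ∧ ℕ ⊨ φ}

/-! ### The sentence PrimeFactor -/

section PrimeFactor

variable {L : FirstOrder.Language.{u, v}}

/-- The symbols occurring in PrimeFactor: constants for `1` and `2`, and binary function symbols
whose standard interpretations take the value `1` exactly on the pairs `(a, b)` with `a ≤ b`,
respectively `a ∣ b`. -/
structure ArithSymbols (L : FirstOrder.Language.{u, v}) [L.Structure ℕ] where
  one : L.Constants
  two : L.Constants
  le : L.Functions 2
  dvd : L.Functions 2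
  one_eq : (one : ℕ) = 1
  two_eq : (two : ℕ) = 2
  le_iff : ∀ a b : ℕ, FirstOrder.Language.Structure.funMap le ![a, b] = 1 ↔ a ≤ b
  dvd_iff : ∀ a b : ℕ, FirstOrder.Language.Structure.funMap dvd ![a, b] = 1 ↔ a ∣ b

variable [L.Structure ℕ] (S : ArithSymbols L) {α : Type} {n : ℕ}

/-- The atomic formula `s ≤ t`, that is, `le(s, t) = 1`. -/
def ArithSymbols.leF (s t : L.Term (α ⊕ Fin n)) : L.BoundedFormula α n :=
  (S.le.apply₂ s t) =' S.one.term

/-- The atomic formula `s ∣ t`, that is, `dvd(s, t) = 1`. -/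
def ArithSymbols.dvdF (s t : L.Term (α ⊕ Fin n)) : L.BoundedFormula α n :=
  (S.dvd.apply₂ s t) =' S.one.term

/-- `PrimeFactor₀(x, y, z)`: `2 ≤ y ∧ y ∣ x ∧ (z ∣ y → (z = 1 ∨ z = y))`. -/
def primeFactor₀ (x y z : L.Term (α ⊕ Fin n)) : L.BoundedFormula α n :=
  S.leF S.two.term y ⊓ (S.dvdF y x ⊓ (S.dvdF z y ⟹ ((z =' S.one.term) ⊔ (z =' y))))

/-- PrimeFactor: `(∀ x ≥ 2) (∃ y ≤ x) (∀ z ≤ y) PrimeFactor₀(x, y, z)`. -/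
def primeFactor : L.Sentence :=
  ∀' (S.leF S.two.term (&0) ⟹
    ∃' (S.leF (&1) (&0) ⊓
      ∀' (S.leF (&2) (&1) ⟹ primeFactor₀ S (&0) (&1) (&2))))

end PrimeFactor

/-! ### Boolean circuits -/

/-- A gate reading from `w` wires. -/
inductive Gate (w : ℕ) : Type
  | const (b : Bool)
  | not (i : Fin w)
  | and (i j : Fin w)
  | or (i j : Fin w)

def Gate.eval {w : ℕ} (x : Fin w → Bool) : Gate w → Bool
  | const b => b
  | not i => !x i
  | and i j => x i && x j
  | or i j => x i || x j

/-- A list of `s` gates on top of `m` input wires: each gate reads input wires and the outputs of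
earlier gates. -/
inductive Gates (m : ℕ) : ℕ → Type
  | nil : Gates m 0
  | snoc {s : ℕ} (G : Gates m s) (g : Gate (m + s)) : Gates m (s + 1)

/-- The values of all wires on a given input. -/
def Gates.wires {m : ℕ} (x : Fin m → Bool) : {s : ℕ} → Gates m s → (Fin (m + s) → Bool)
  | _, nil => x
  | _, snoc G g => Fin.snoc (α := fun _ => Bool) (G.wires x) (g.eval (G.wires x))

/-- A Boolean circuit (fan-in two, unbounded fan-out) with `m` inputs and `k` outputs. Its size is
its number of gates. -/
structure BoolCircuit (m k : ℕ) where
  size : ℕ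
  gates : Gates m size
  output : Fin k → Fin (m + size)

def BoolCircuit.eval {m k : ℕ} (C : BoolCircuit m k) (x : Fin m → Bool) : Fin k → Bool :=
  fun i => C.gates.wires x (C.output i)

/-- The circuit as a function on numbers: it reads the `m` lowest binary digits of `a` (the `i`-th
input being the digit of weight `2 ^ i`), and its `k` outputs are the digits of its value. -/
def BoolCircuit.evalNat {m k : ℕ} (C : BoolCircuit m k) (a : ℕ) : ℕ :=
  ∑ i : Fin k, if C.eval (fun j => a.testBit j) i then 2 ^ (i : ℕ) else 0

/-! ### Average-case hardness of factoring -/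

/-- The set of all primes of binary length `n`. -/
def primesOfLength (n : ℕ) : Finset ℕ :=
  {p ∈ Finset.range (2 ^ n) | p.Prime ∧ p.size = n}

/-- The probability, over independent uniformly random primes `p`, `q` of length `n`, that the
circuit outputs `p` or `q` on input `p * q`. (The product has at most `2 * n` digits.) -/
noncomputable def successProb {n : ℕ} (C : BoolCircuit (2 * n) n) : ℝ :=
  (({pq ∈ primesOfLength n ×ˢ primesOfLength n |
      C.evalNat (pq.1 * pq.2) = pq.1 ∨ C.evalNat (pq.1 * pq.2) = pq.2}.card : ℕ) : ℝ) /
    ((primesOfLength n ×ˢ primesOfLength n).card : ℕ)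

/-- For every `r > 0` and every sequence of circuits of polynomial size there is a length `n`, for
which primes of length `n` exist, at which the probability of success is below `r`. -/
def FactoringHard : Prop :=
  ∀ r : ℝ, 0 < r → ∀ C : (n : ℕ) → BoolCircuit (2 * n) n,
    (∃ P : Polynomial ℕ, ∀ n, (C n).size ≤ P.eval n) →
      ∃ n, (primesOfLength n).Nonempty ∧ successProb (C n) < r

end PVFactor

open PVFactor

/-! # PrimeFactor is not provable in the true universal theory of polynomial time

Polynomial-time functions have circuits of polynomial size. If factoring is hard on average for such
circuits, then a model of the true universal theory in which PrimeFactor fails is built from the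
terms of a game between a student, who proposes prime factors, and a teacher, who refutes them. -/

/-! PrimeFactor is made to fail at a product `x` of distinct primes indexed by the cube `{0,1}^D`.
The elements of the model are limits of values of closed terms built from the PV symbols, `x`, and a
teacher's function `cex`. Since factoring is hard, feasible computation cannot tell the primes apart
by itself; only the answers of `cex` distinguish them. So the primes can be chosen such that, if the
value of a term with `d` nested `cex` divides `x`, the set of indices of its prime factors depends
on the first `d` coordinates alone (`Nonsep`). If that value is at least 2, the next coordinate cuts
this set into two nonempty halves, and the product over one half is a proper nontrivial divisor.
This is the answer of `cex`, and it refutes every candidate for a prime factor (`cex_refutes`).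

The choice of primes is `exists_nonseparating`. If it failed for a finite set of terms, then at
every length each tuple of primes would have a repetition or a separating term. The number of
possible patterns of divisibility does not depend on the length, so one of them, or one collision,
has probability bounded below. For a pattern, take a separating term `t` of least size, and points
`v`, `w` that it separates although they agree on the first `depth t` coordinates. Put unknown
primes `a`, `b` at `v`, `w` and fix the others by averaging. The smaller terms needed treat `v` and
`w` alike, so the value of `t` is computable from `a * b` (`exists_cost_eval`); it is `a` times a
known odd number, which reveals `a`. Circuits of polynomial size would then factor with probability
bounded below at every length.

The circuits come from simulating machines (`PolyTime.exists_cost`). The finite approximations are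
glued by an ultraproduct, and universal sentences pass to the substructure of values of terms
(`exists_limit_model`). -/

namespace PVFactor

/-! ### Circuit cost of families of predicates -/

section Cost

variable {X : Type*} {A A' B B' C : Set (X → Prop)} {c d : ℕ}

/-- The predicates computed by one gate from the predicates in `W`. -/
inductive GateOver (W : Set (X → Prop)) : (X → Prop) → Prop
  | not {p : X → Prop} : p ∈ W → GateOver W fun x => ¬ p x
  | and {p q : X → Prop} : p ∈ W → q ∈ W → GateOver W fun x => p x ∧ q x
  | or {p q : X → Prop} : p ∈ W → q ∈ W → GateOver W fun x => p x ∨ q x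

/-- `Build A c W`: adding `c` gates one after the other to the predicates in `A` gives `W`. -/
inductive Build (A : Set (X → Prop)) : ℕ → Set (X → Prop) → Prop
  | nil : Build A 0 A
  | gate {c : ℕ} {W : Set (X → Prop)} {g : X → Prop} :
      Build A c W → GateOver W g → Build A (c + 1) (insert g W)

/-- The constant predicates. -/
def constPreds (X : Type*) : Set (X → Prop) := {p | ∃ b : Prop, p = fun _ => b}

/-- The predicates in `B` can all be computed from those in `A` and constants by a circuit with at
most `c` gates. -/
def Cost (A B : Set (X → Prop)) (c : ℕ) : Prop :=
  ∃ d ≤ c, ∃ W, Build (A ∪ constPreds X) d W ∧ B ⊆ W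

theorem GateOver.mono {W W' : Set (X → Prop)} (h : W ⊆ W') {g : X → Prop} (hg : GateOver W g) :
    GateOver W' g := by
  cases hg with
  | not hp => exact .not (h hp)
  | and hp hq => exact .and (h hp) (h hq)
  | or hp hq => exact .or (h hp) (h hq)

theorem Build.union {W : Set (X → Prop)} (h : Build A c W) (A' : Set (X → Prop)) :
    Build (A ∪ A') c (W ∪ A') := by
  induction h with
  | nil => exact .nil
  | gate _ hg ih =>
    rw [Set.insert_union]
    exact .gate ih (hg.mono Set.subset_union_left)

theorem Build.subset {W : Set (X → Prop)} (h : Build A c W) : A ⊆ W := by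
  induction h with
  | nil => exact subset_rfl
  | gate _ _ ih => exact ih.trans (Set.subset_insert _ _)

theorem Build.append {W V : Set (X → Prop)} (h : Build A c W) (h' : Build W d V) :
    Build A (c + d) V := by
  induction h' with
  | nil => exact h
  | gate _ hg ih => exact .gate ih hg

theorem Build.of_subset {W V : Set (X → Prop)} (h : Build A c W) (hA : A ⊆ V) :
    Build V c (W ∪ V) := by
  have := h.union V
  rwa [Set.union_eq_self_of_subset_left hA] at this

theorem Cost.of_subset (h : B ⊆ A ∪ constPreds X) : Cost A B c :=
  ⟨0, Nat.zero_le _, _, .nil, h⟩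

theorem Cost.refl : Cost A A c := .of_subset Set.subset_union_left

theorem Cost.mono (h : Cost A B c) (hA : A ⊆ A') (hB : B' ⊆ B) (hc : c ≤ d) : Cost A' B' d := by
  obtain ⟨e, he, W, hW, hBW⟩ := h
  exact ⟨e, he.trans hc, _, hW.of_subset (Set.union_subset_union_left _ hA),
    (hB.trans hBW).trans Set.subset_union_left⟩

theorem Cost.trans (h : Cost A B c) (h' : Cost B C d) : Cost A C (c + d) := by
  obtain ⟨e, he, W, hW, hBW⟩ := h
  obtain ⟨f, hf, V, hV, hCV⟩ := h'
  refine ⟨e + f, by omega, _, hW.append (hV.of_subset (Set.union_subset hBW ?_)),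
    hCV.trans Set.subset_union_left⟩
  exact Set.subset_union_right.trans hW.subset

theorem Cost.union (h : Cost A B c) (h' : Cost A C d) : Cost A (B ∪ C) (c + d) := by
  obtain ⟨e, he, W, hW, hBW⟩ := h
  obtain ⟨f, hf, V, hV, hCV⟩ := h'
  refine ⟨e + f, by omega, _, hW.append (hV.of_subset hW.subset), ?_⟩
  exact Set.union_subset (hBW.trans Set.subset_union_right) (hCV.trans Set.subset_union_left)

theorem Cost.trans_union (h : Cost A B c) (h' : Cost (A ∪ B) C d) : Cost A C (c + d) := by
  have := (Cost.refl (A := A) (c := 0)).union h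
  exact (this.trans h').mono subset_rfl subset_rfl (by omega)

theorem Cost.gate {g : X → Prop} (h : GateOver (A ∪ constPreds X) g) : Cost A {g} 1 :=
  ⟨1, le_rfl, _, .gate .nil h, by simp⟩

theorem Cost.not {p : X → Prop} (hp : p ∈ A) : Cost A {fun x => ¬ p x} 1 :=
  .gate (.not (.inl hp))

theorem Cost.and {p q : X → Prop} (hp : p ∈ A) (hq : q ∈ A) : Cost A {fun x => p x ∧ q x} 1 :=
  .gate (.and (.inl hp) (.inl hq))

theorem Cost.or {p q : X → Prop} (hp : p ∈ A) (hq : q ∈ A) : Cost A {fun x => p x ∨ q x} 1 :=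
  .gate (.or (.inl hp) (.inl hq))

theorem Cost.biUnion {J : Type*} (s : Finset J) (P : J → Set (X → Prop)) (c : J → ℕ)
    (h : ∀ j ∈ s, Cost A (P j) (c j)) : Cost A (⋃ j ∈ s, P j) (∑ j ∈ s, c j) := by
  classical
  induction s using Finset.induction_on with
  | empty => exact .of_subset (by simp)
  | insert j s hj ih =>
    rw [Finset.sum_insert hj, Finset.set_biUnion_insert]
    exact (h j (by simp)).union (ih fun i hi => h i (by simp [hi]))

/-- Constants are free, so `B` may be described by infinitely many indices as long as only those in
`s` give nonconstant predicates. -/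
theorem Cost.family {J : Type*} (s : Finset J) (P : J → X → Prop)
    (h : ∀ j ∈ s, Cost A {P j} c) (hB : ∀ p ∈ B, (∃ j ∈ s, p = P j) ∨ p ∈ constPreds X) :
    Cost A B (s.card * c) := by
  obtain ⟨d, hd, W, hW, hs⟩ := Cost.biUnion s (fun j => {P j}) (fun _ => c) h
  refine ⟨d, by simpa using hd, W, hW, fun p hp => ?_⟩
  rcases hB p hp with ⟨j, hj, rfl⟩ | hc
  · exact hs (by simpa using ⟨j, hj, rfl⟩)
  · exact hW.subset (.inr hc)

theorem Cost.exists_mem {J : Type*} (s : Finset J) (P : J → X → Prop) (h : ∀ j ∈ s, P j ∈ A) :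
    Cost A {fun x => ∃ j ∈ s, P j x} s.card := by
  classical
  induction s using Finset.induction_on with
  | empty => exact .of_subset (by rintro _ rfl; exact .inr ⟨False, by simp⟩)
  | insert j s hj ih =>
    rw [Finset.card_insert_of_notMem hj]
    refine Cost.trans_union (ih fun i hi => h i (by simp [hi])) ?_
    have := Cost.or (A := A ∪ {fun x => ∃ j ∈ s, P j x}) (.inl (h j (by simp))) (.inr rfl)
    refine this.mono subset_rfl ?_ le_rfl
    simp

/-- The predicates on `X` saying that an observation `obs j` holds of the value of `h`. -/
def obsWires {J α : Type*} (obs : J → α → Prop) (h : X → α) : Set (X → Prop) :=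
  Set.range fun j x => obs j (h x)

/-- The predicates on `X` saying which value `h` takes. -/
abbrev hot {α : Type*} (h : X → α) : Set (X → Prop) := obsWires (fun a b => b = a) h

theorem mem_hot {α : Type*} (h : X → α) (a : α) : (fun x => h x = a) ∈ hot h := ⟨a, rfl⟩

/-- A multiplexer: the disjunction over `i` of `sel x = i ∧ Q i x`, with one conjunction and one
disjunction for each `i`. -/
theorem Cost.select_pred {ι : Type*} [Fintype ι] (sel : X → ι) (hsel : hot sel ⊆ A)
    (Q : ι → X → Prop) (hQ : ∀ i, Q i ∈ A) :
    Cost A {fun x => Q (sel x) x} (2 * Fintype.card ι) := by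
  have h1 : Cost A (Set.range fun i x => sel x = i ∧ Q i x) (Fintype.card ι * 1) := by
    refine Cost.family Finset.univ (fun i x => sel x = i ∧ Q i x)
      (fun i _ => .and (hsel (mem_hot _ _)) (hQ i)) ?_
    rintro p ⟨i, rfl⟩
    exact .inl ⟨i, Finset.mem_univ _, rfl⟩
  have h2 := Cost.exists_mem (A := Set.range fun i x => sel x = i ∧ Q i x) Finset.univ
    (fun i x => sel x = i ∧ Q i x) (fun i _ => ⟨i, rfl⟩)
  refine (h1.trans h2).mono subset_rfl ?_ (by simp; omega)
  simp

theorem Cost.select {ι J α : Type*} [Fintype ι] (sel : X → ι) (hsel : hot sel ⊆ A)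
    (obs : J → α → Prop) (R : ι → X → α) (hR : ∀ i, obsWires obs (R i) ⊆ A) (s : Finset J)
    (hs : ∀ j ∉ s, ∃ b : Prop, ∀ i x, obs j (R i x) ↔ b) :
    Cost A (obsWires obs fun x => R (sel x) x) (s.card * (2 * Fintype.card ι)) := by
  refine Cost.family s (fun j x => obs j (R (sel x) x)) (fun j _ => ?_) ?_
  · exact Cost.select_pred sel hsel (fun i x => obs j (R i x)) fun i => hR i ⟨j, rfl⟩
  · rintro p ⟨j, rfl⟩
    by_cases hj : j ∈ s
    · exact .inl ⟨j, hj, rfl⟩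
    · obtain ⟨b, hb⟩ := hs j hj
      exact .inr ⟨b, funext fun x => propext (hb _ _)⟩

/-- For each value `b` attained on `S`, the wire `φ (h x) = b` is the disjunction of the wires `h x
= a` over the fibre of `b`. -/
theorem Cost.comp_hot {α β : Type*} (h : X → α) (φ : α → β) (S : Finset α)
    (hS : ∀ x, h x ∈ S) (hA : hot h ⊆ A) :
    Cost A (hot fun x => φ (h x)) (S.card * S.card) := by
  classical
  refine (Cost.family (c := S.card) (S.image φ) (fun b x => φ (h x) = b) (fun b _ => ?_) ?_).mono
    subset_rfl subset_rfl (Nat.mul_le_mul_right _ Finset.card_image_le)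
  · refine (Cost.exists_mem (S.filter fun a => φ a = b) (fun a x => h x = a)
      fun a _ => hA (mem_hot _ _)).mono subset_rfl ?_ (Finset.card_filter_le _ _)
    rintro _ rfl
    refine funext fun x => propext ⟨fun hb => ⟨h x, by simp [hS, hb], rfl⟩, ?_⟩
    rintro ⟨a, ha, rfl⟩
    exact (Finset.mem_filter.1 ha).2
  · rintro _ ⟨b, rfl⟩
    by_cases hb : b ∈ S.image φ
    · exact .inl ⟨b, hb, rfl⟩
    · refine .inr ⟨False, funext fun x => eq_false ?_⟩
      rintro rfl
      exact hb (Finset.mem_image_of_mem _ (hS x))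

theorem Cost.pair_hot {α β : Type*} (h : X → α) (h' : X → β) (S : Finset α) (T : Finset β)
    (hS : ∀ x, h x ∈ S) (hT : ∀ x, h' x ∈ T) (hA : hot h ⊆ A) (hA' : hot h' ⊆ A) :
    Cost A (hot fun x => (h x, h' x)) (S.card * T.card) := by
  refine (Cost.family (c := 1) (S ×ˢ T) (fun ab x => (h x, h' x) = ab) (fun ab _ => ?_) ?_).mono
    subset_rfl subset_rfl (by simp)
  · refine (Cost.and (hA (mem_hot h ab.1)) (hA' (mem_hot h' ab.2))).mono subset_rfl ?_ le_rfl
    simp [Prod.ext_iff]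
  · rintro _ ⟨ab, rfl⟩
    by_cases hab : ab ∈ S ×ˢ T
    · exact .inl ⟨ab, hab, rfl⟩
    · refine .inr ⟨False, funext fun x => eq_false ?_⟩
      rintro rfl
      exact hab (Finset.mem_product.2 ⟨hS x, hT x⟩)

end Cost

/-! ### Stacks and configurations as families of wires -/

section Stacks

set_option linter.unusedSectionVars false

variable {X : Type} {A B : Set (X → Prop)} {c : ℕ}

theorem obsWires_const {J α : Type*} (obs : J → α → Prop) (a : α) :
    obsWires obs (fun _ : X => a) ⊆ constPreds X := by
  rintro _ ⟨j, rfl⟩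
  exact ⟨obs j a, rfl⟩

/-- The predicates on `X` saying what the `i`-th entry of the list `l` is. -/
abbrev cells {Γ : Type} (l : X → List Γ) : Set (X → Prop) :=
  obsWires (fun (j : ℕ × Option Γ) (l : List Γ) => l[j.1]? = j.2) l

/-- Positions are counted from the top of the stack, so pushing only renames wires and needs no
gates; the same holds for popping. -/
theorem cells_cons {Γ : Type} (g : X → Γ) (l : X → List Γ) :
    cells (fun x => g x :: l x) ⊆ (hot g ∪ cells l) ∪ constPreds X := by
  rintro _ ⟨⟨i | i, o⟩, rfl⟩
  · cases o with
    | none => exact .inr ⟨False, by simp⟩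
    | some a => exact .inl (.inl ⟨a, by simp⟩)
  · exact .inl (.inr ⟨(i, o), by simp⟩)

theorem cells_tail {Γ : Type} (l : X → List Γ) : cells (fun x => (l x).tail) ⊆ cells l := by
  rintro _ ⟨⟨i, o⟩, rfl⟩
  exact ⟨(i + 1, o), by simp⟩

theorem hot_head? {Γ : Type} (l : X → List Γ) : hot (fun x => (l x).head?) ⊆ cells l := by
  rintro _ ⟨o, rfl⟩
  exact ⟨(0, o), by simp [List.head?_eq_getElem?]⟩

theorem cells_map {Γ Γ' : Type} (e : Γ ≃ Γ') (l : X → List Γ) :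
    cells (fun x => (l x).map e) ⊆ cells l := by
  rintro _ ⟨⟨i, o⟩, rfl⟩
  refine ⟨(i, o.map e.symm), funext fun x => propext ?_⟩
  simp only [List.getElem?_map]
  cases h : (l x)[i]? <;> cases o <;> simp [Equiv.eq_symm_apply]

/-- Only positions below `H`, with content in `S` or empty, carry nonconstant wires, hence the `H *
(S.card + 1)` multiplexers. -/
theorem Cost.select_cells {ι Γ : Type} [Fintype ι] (sel : X → ι) (hsel : hot sel ⊆ A)
    (R : ι → X → List Γ) (hR : ∀ i, cells (R i) ⊆ A) (H : ℕ) (S : Finset Γ)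
    (hH : ∀ i x, (R i x).length ≤ H) (hS : ∀ i x, ∀ a ∈ R i x, a ∈ S) :
    Cost A (cells fun x => R (sel x) x) (H * (S.card + 1) * (2 * Fintype.card ι)) := by
  refine (Cost.select sel hsel _ R hR (Finset.range H ×ˢ Finset.insertNone S) ?_).mono
    subset_rfl subset_rfl (by simp)
  rintro ⟨i, o⟩ hj
  by_cases hi : i < H
  · cases o with
    | none => simp [hi] at hj
    | some a =>
      refine ⟨False, fun j x => iff_false_intro fun h => ?_⟩
      have := hS j x a (List.mem_of_getElem? h)
      simp [hi, this] at hj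
  · refine ⟨none = o, fun j x => ?_⟩
    have : (R j x)[i]? = none := List.getElem?_eq_none ((hH j x).trans (not_lt.1 hi))
    simp [this]

open Turing

variable {K Λ σ : Type} {Γ : K → Type} [DecidableEq K] [Fintype K] [Fintype Λ] [Fintype σ]

/-- All stacks have height at most `H` and entries in the given finite sets. -/
def StackBound (syms : ∀ k, Finset (Γ k)) (H : ℕ) (S : ∀ k, List (Γ k)) : Prop :=
  ∀ k, (S k).length ≤ H ∧ ∀ a ∈ S k, a ∈ syms k

abbrev stackWires (S : X → ∀ k, List (Γ k)) : Set (X → Prop) := ⋃ k, cells fun x => S x k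

/-- The predicates on `X` describing a configuration. -/
def cfgWires (C : X → TM2.Cfg Γ Λ σ) : Set (X → Prop) :=
  hot (fun x => (C x).l) ∪ (hot (fun x => (C x).var) ∪ stackWires fun x => (C x).stk)

theorem cells_subset_stackWires (S : X → ∀ k, List (Γ k)) (k : K) :
    cells (fun x => S x k) ⊆ stackWires S :=
  Set.subset_iUnion (fun k => cells fun x => S x k) k

theorem StackBound.mono {syms : ∀ k, Finset (Γ k)} {H H' : ℕ} {S : ∀ k, List (Γ k)}
    (h : StackBound syms H S) (hH : H ≤ H') : StackBound syms H' S :=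
  fun k => ⟨(h k).1.trans hH, (h k).2⟩

/-- A bound for the number of wires describing a configuration per unit of stack height. -/
def cfgSize (Λ σ : Type) [Fintype Λ] [Fintype σ] (syms : ∀ k, Finset (Γ k)) : ℕ :=
  Fintype.card Λ + 1 + Fintype.card σ + ∑ k, ((syms k).card + 1)

theorem Cost.select_cfg {ι : Type} [Fintype ι] (sel : X → ι) (hsel : hot sel ⊆ A)
    (R : ι → X → TM2.Cfg Γ Λ σ) (hR : ∀ i, cfgWires (R i) ⊆ A) (H : ℕ)
    (syms : ∀ k, Finset (Γ k)) (hH : ∀ i x, StackBound syms H (R i x).stk) :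
    Cost A (cfgWires fun x => R (sel x) x)
      (cfgSize Λ σ syms * (2 * Fintype.card ι) * (H + 1)) := by
  have h1 : Cost A (hot fun x => (R (sel x) x).l)
      ((Fintype.card Λ + 1) * (2 * Fintype.card ι)) := by
    refine (Cost.select sel hsel (fun a b => b = a) (fun i x => (R i x).l)
      (fun i => Set.subset_union_left.trans (hR i)) Finset.univ (by simp)).mono
      subset_rfl subset_rfl (by simp)
  have h2 : Cost A (hot fun x => (R (sel x) x).var)
      (Fintype.card σ * (2 * Fintype.card ι)) := by
    refine (Cost.select sel hsel (fun a b => b = a) (fun i x => (R i x).var)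
      (fun i => (Set.subset_union_left.trans Set.subset_union_right).trans (hR i))
      Finset.univ (by simp)).mono subset_rfl subset_rfl (by simp)
  have h3 : Cost A (stackWires fun x => (R (sel x) x).stk)
      (∑ k, H * ((syms k).card + 1) * (2 * Fintype.card ι)) := by
    refine (Cost.biUnion Finset.univ (fun k => cells fun x => (R (sel x) x).stk k) _
      fun k _ => Cost.select_cells sel hsel (fun i x => (R i x).stk k) (fun i => ?_) H (syms k)
        (fun i x => (hH i x k).1) (fun i x => (hH i x k).2)).mono subset_rfl ?_ le_rfl
    · exact (cells_subset_stackWires _ k).trans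
        ((Set.subset_union_right.trans Set.subset_union_right).trans (hR i))
    · simp [stackWires]
  refine (h1.union (h2.union h3)).mono subset_rfl subset_rfl ?_
  rw [cfgSize, ← Finset.sum_mul, ← Finset.mul_sum]
  set a := ∑ k, ((syms k).card + 1)
  set i := 2 * Fintype.card ι
  set b := (Fintype.card Λ + 1)
  set d := Fintype.card σ
  have e : (b + d + a) * i * (H + 1) =
    b * i + (d * i + H * a * i) + (b * i * H + d * i * H + a * i) := by ring
  omega

/-! ### The gates for one statement of a machine -/

/-- All symbols that the statement can push are in the given finite sets. -/
def PushesIn (syms : ∀ k, Finset (Γ k)) : TM2.Stmt Γ Λ σ → Prop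
  | .push k f q => (∀ v, f v ∈ syms k) ∧ PushesIn syms q
  | .peek _ _ q => PushesIn syms q
  | .pop _ _ q => PushesIn syms q
  | .load _ q => PushesIn syms q
  | .branch _ q₁ q₂ => PushesIn syms q₁ ∧ PushesIn syms q₂
  | .goto _ => True
  | .halt => True

theorem PushesIn.mono {syms syms' : ∀ k, Finset (Γ k)} (h : ∀ k, syms k ⊆ syms' k)
    {q : TM2.Stmt Γ Λ σ} (hq : PushesIn syms q) : PushesIn syms' q := by
  induction q with
  | push k f q ih => exact ⟨fun v => h k (hq.1 v), ih hq.2⟩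
  | peek k f q ih => exact ih hq
  | pop k f q ih => exact ih hq
  | load f q ih => exact ih hq
  | branch f q₁ q₂ ih₁ ih₂ => exact ⟨ih₁ hq.1, ih₂ hq.2⟩
  | goto f => trivial
  | halt => trivial

/-- The stack alphabets may be infinite, but a pushed symbol is a function of the state, and there
are finitely many states. -/
theorem exists_pushesIn (q : TM2.Stmt Γ Λ σ) : ∃ syms, PushesIn syms q := by
  classical
  induction q with
  | push k f q ih =>
    obtain ⟨syms, h⟩ := ih
    refine ⟨Function.update syms k (syms k ∪ Finset.univ.image f), by simp, h.mono fun j => ?_⟩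
    by_cases hj : j = k
    · subst hj; simp
    · simp [hj]
  | peek k f q ih => exact ih
  | pop k f q ih => exact ih
  | load f q ih => exact ih
  | branch f q₁ q₂ ih₁ ih₂ =>
    obtain ⟨s₁, h₁⟩ := ih₁
    obtain ⟨s₂, h₂⟩ := ih₂
    exact ⟨fun k => s₁ k ∪ s₂ k, h₁.mono fun k => Finset.subset_union_left,
      h₂.mono fun k => Finset.subset_union_right⟩
  | goto f => exact ⟨fun _ => ∅, trivial⟩
  | halt => exact ⟨fun _ => ∅, trivial⟩

theorem StackBound.cons {syms : ∀ k, Finset (Γ k)} {H : ℕ} {S : ∀ k, List (Γ k)}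
    (h : StackBound syms H S) {k : K} {a : Γ k} (ha : a ∈ syms k) :
    StackBound syms (H + 1) (Function.update S k (a :: S k)) := by
  intro j
  by_cases hj : j = k
  · subst hj
    simpa [ha] using h j
  · simpa [hj] using h.mono (Nat.le_succ H) j

theorem StackBound.tail {syms : ∀ k, Finset (Γ k)} {H : ℕ} {S : ∀ k, List (Γ k)}
    (h : StackBound syms H S) (k : K) :
    StackBound syms H (Function.update S k (S k).tail) := by
  intro j
  by_cases hj : j = k
  · subst hj
    simp only [Function.update_self, List.length_tail]
    exact ⟨(Nat.sub_le _ _).trans (h j).1, fun a ha => (h j).2 a (List.mem_of_mem_tail ha)⟩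
  · simpa [hj] using h j

theorem stackWires_update (S : X → ∀ k, List (Γ k)) (k : K) (l : X → List (Γ k)) :
    stackWires (fun x => Function.update (S x) k (l x)) ⊆ cells l ∪ stackWires S := by
  refine Set.iUnion_subset fun j => ?_
  by_cases hj : j = k
  · subst hj
    simp
  · simp only [Function.update_of_ne hj]
    exact (cells_subset_stackWires S j).trans Set.subset_union_right

theorem Cost.comp_var {γ : Type} (v : X → σ) (f : σ → γ) (hA : hot v ⊆ A) :
    Cost A (hot fun x => f (v x)) (Fintype.card σ * Fintype.card σ) :=
  Cost.comp_hot v f Finset.univ (by simp) hA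

/-- The cost of applying a function to a state and the top of a stack. -/
def headCost (s t : ℕ) : ℕ := s * (t + 1) + s * (t + 1) * (s * (t + 1))

theorem Cost.comp_head {γ : Type} (v : X → σ) (l : X → List γ) (f : σ → Option γ → σ)
    (T : Finset γ) (hT : ∀ x, ∀ a ∈ l x, a ∈ T) (hA : hot v ⊆ A) (hA' : cells l ⊆ A) :
    Cost A (hot fun x => f (v x) (l x).head?) (headCost (Fintype.card σ) T.card) := by
  have hT' : ∀ x, (l x).head? ∈ Finset.insertNone T := by
    intro x
    rw [Finset.mem_insertNone]
    intro a ha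
    exact hT x a (List.mem_of_head? ha)
  have h1 := Cost.pair_hot v (fun x => (l x).head?) Finset.univ (Finset.insertNone T) (by simp)
    hT' hA ((hot_head? l).trans hA')
  have h2 := Cost.comp_hot (fun x => (v x, (l x).head?)) (fun p => f p.1 p.2)
    (Finset.univ ×ˢ Finset.insertNone T) (fun x => Finset.mem_product.2 ⟨by simp, hT' x⟩) subset_rfl
  exact (h1.trans h2).mono subset_rfl subset_rfl (by simp [headCost])

/-- One statement of a machine costs a number of gates linear in the stack height. -/
theorem exists_cost_stepAux (syms : ∀ k, Finset (Γ k)) (q : TM2.Stmt Γ Λ σ)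
    (hq : PushesIn syms q) :
    ∃ c b : ℕ, ∀ (X : Type) (v : X → σ) (S : X → ∀ k, List (Γ k)) (H : ℕ),
      (∀ x, StackBound syms H (S x)) →
        Cost (hot v ∪ stackWires S) (cfgWires fun x => TM2.stepAux q (v x) (S x)) (c * (H + 1)) ∧
          ∀ x, StackBound syms (H + b) (TM2.stepAux q (v x) (S x)).stk := by
  induction q with
  | push k f q ih =>
    obtain ⟨c, b, h⟩ := ih hq.2
    -- The rest of the statement runs on stacks of height up to `H + 1`, and `c * (H + 2) ≤ 2 * c *
    -- (H + 1)`.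
    refine ⟨Fintype.card σ * Fintype.card σ + 2 * c, b + 1, fun X v S H hS => ?_⟩
    obtain ⟨h1, h2⟩ := h X v (fun x => Function.update (S x) k (f (v x) :: S x k)) (H + 1)
      fun x => (hS x).cons (hq.1 _)
    refine ⟨?_, fun x => (h2 x).mono (by omega)⟩
    have e1 := Cost.comp_var (A := hot v ∪ stackWires S) v f Set.subset_union_left
    have e2 : Cost ((hot v ∪ stackWires S) ∪ hot (fun x => f (v x)))
        (hot v ∪ stackWires fun x => Function.update (S x) k (f (v x) :: S x k)) 0 := by
      refine .of_subset (Set.union_subset ?_ ((stackWires_update _ _ _).trans ?_))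
      · exact fun p hp => .inl (.inl (.inl hp))
      · refine Set.union_subset ((cells_cons _ _).trans ?_) ?_
        · rintro p ((hp | hp) | hp)
          · exact .inl (.inr hp)
          · exact .inl (.inl (.inr (cells_subset_stackWires S k hp)))
          · exact .inr hp
        · exact fun p hp => .inl (.inl (.inr hp))
    refine ((e1.trans_union e2).trans h1).mono subset_rfl subset_rfl ?_
    nlinarith [Nat.zero_le (Fintype.card σ * Fintype.card σ * H), Nat.zero_le (c * H)]
  | peek k f q ih =>
    obtain ⟨c, b, h⟩ := ih hq
    refine ⟨headCost (Fintype.card σ) (syms k).card + c, b, fun X v S H hS => ?_⟩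
    · obtain ⟨h1, h2⟩ := h X (fun x => f (v x) (S x k).head?) S H hS
      refine ⟨?_, h2⟩
      have e1 := Cost.comp_head (A := hot v ∪ stackWires S) v (fun x => S x k) f (syms k)
        (fun x => (hS x k).2) Set.subset_union_left
        ((cells_subset_stackWires S k).trans Set.subset_union_right)
      have e2 : Cost ((hot v ∪ stackWires S) ∪ hot (fun x => f (v x) (S x k).head?))
          (hot (fun x => f (v x) (S x k).head?) ∪ stackWires S) 0 := by
        refine .of_subset (Set.union_subset ?_ ?_)
        · exact fun p hp => .inl (.inr hp)
        · exact fun p hp => .inl (.inl (.inr hp))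
      refine ((e1.trans_union e2).trans h1).mono subset_rfl subset_rfl ?_
      rw [add_zero, add_mul]
      exact Nat.add_le_add_right (Nat.le_mul_of_pos_right _ (Nat.succ_pos H)) _
  | pop k f q ih =>
    obtain ⟨c, b, h⟩ := ih hq
    refine ⟨headCost (Fintype.card σ) (syms k).card + c, b, fun X v S H hS => ?_⟩
    · obtain ⟨h1, h2⟩ := h X (fun x => f (v x) (S x k).head?)
        (fun x => Function.update (S x) k (S x k).tail) H fun x => (hS x).tail k
      refine ⟨?_, h2⟩
      have e1 := Cost.comp_head (A := hot v ∪ stackWires S) v (fun x => S x k) f (syms k)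
        (fun x => (hS x k).2) Set.subset_union_left
        ((cells_subset_stackWires S k).trans Set.subset_union_right)
      have e2 : Cost ((hot v ∪ stackWires S) ∪ hot (fun x => f (v x) (S x k).head?))
          (hot (fun x => f (v x) (S x k).head?) ∪
            stackWires fun x => Function.update (S x) k (S x k).tail) 0 := by
        refine .of_subset (Set.union_subset ?_ ((stackWires_update _ _ _).trans ?_))
        · exact fun p hp => .inl (.inr hp)
        · refine Set.union_subset ((cells_tail _).trans ?_) ?_
          · exact fun p hp => .inl (.inl (.inr (cells_subset_stackWires S k hp)))
          · exact fun p hp => .inl (.inl (.inr hp))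
      refine ((e1.trans_union e2).trans h1).mono subset_rfl subset_rfl ?_
      rw [add_zero, add_mul]
      exact Nat.add_le_add_right (Nat.le_mul_of_pos_right _ (Nat.succ_pos H)) _
  | load f q ih =>
    obtain ⟨c, b, h⟩ := ih hq
    refine ⟨Fintype.card σ * Fintype.card σ + c, b, fun X v S H hS => ?_⟩
    · obtain ⟨h1, h2⟩ := h X (fun x => f (v x)) S H hS
      refine ⟨?_, h2⟩
      have e1 := Cost.comp_var (A := hot v ∪ stackWires S) v f Set.subset_union_left
      have e2 : Cost ((hot v ∪ stackWires S) ∪ hot (fun x => f (v x)))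
          (hot (fun x => f (v x)) ∪ stackWires S) 0 := by
        refine .of_subset (Set.union_subset ?_ ?_)
        · exact fun p hp => .inl (.inr hp)
        · exact fun p hp => .inl (.inl (.inr hp))
      refine ((e1.trans_union e2).trans h1).mono subset_rfl subset_rfl ?_
      rw [add_zero, add_mul]
      exact Nat.add_le_add_right (Nat.le_mul_of_pos_right _ (Nat.succ_pos H)) _
  | branch f q₁ q₂ ih₁ ih₂ =>
    obtain ⟨c₁, b₁, h₁⟩ := ih₁ hq.1
    obtain ⟨c₂, b₂, h₂⟩ := ih₂ hq.2
    refine ⟨c₁ + c₂ + cfgSize Λ σ syms * (2 * Fintype.card σ) * (b₁ + b₂ + 1), b₁ + b₂,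
      fun X v S H hS => ?_⟩
    obtain ⟨e₁, g₁⟩ := h₁ X v S H hS
    obtain ⟨e₂, g₂⟩ := h₂ X v S H hS
    refine ⟨?_, fun x => ?_⟩
    -- Both branches are computed, and the state then selects one of the two resulting
    -- configurations.
    · let R : σ → X → TM2.Cfg Γ Λ σ := fun s x =>
        cond (f s) (TM2.stepAux q₁ (v x) (S x)) (TM2.stepAux q₂ (v x) (S x))
      have h3 := Cost.select_cfg (A := (hot v ∪ stackWires S) ∪
        (cfgWires (fun x => TM2.stepAux q₁ (v x) (S x)) ∪
          cfgWires fun x => TM2.stepAux q₂ (v x) (S x))) v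
        (Set.subset_union_left.trans Set.subset_union_left) R ?_ (H + (b₁ + b₂)) syms ?_
      · refine ((e₁.union e₂).trans_union h3).mono subset_rfl subset_rfl ?_
        set m := cfgSize Λ σ syms * (2 * Fintype.card σ)
        have : m * (H + (b₁ + b₂) + 1) ≤ m * (b₁ + b₂ + 1) * (H + 1) := by
          rw [mul_assoc m]
          exact Nat.mul_le_mul_left m (by nlinarith [Nat.zero_le ((b₁ + b₂) * H)])
        calc _ ≤ c₁ * (H + 1) + c₂ * (H + 1) + m * (b₁ + b₂ + 1) * (H + 1) := by omega
          _ = _ := by ring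
      · intro s
        cases hs : f s <;> simp only [R, hs, cond_true, cond_false]
        · exact fun p hp => .inr (.inr hp)
        · exact fun p hp => .inr (.inl hp)
      · intro s x
        cases hs : f s <;> simp only [R, hs, cond_true, cond_false]
        · exact (g₂ x).mono (by omega)
        · exact (g₁ x).mono (by omega)
    · simp only [TM2.stepAux]
      cases hs : f (v x) <;> simp only [cond_true, cond_false]
      · exact (g₂ x).mono (by omega)
      · exact (g₁ x).mono (by omega)
  | goto f =>
    refine ⟨Fintype.card σ * Fintype.card σ, 0, fun X v S H hS => ⟨?_, hS⟩⟩
    have e1 := Cost.comp_var (A := hot v ∪ stackWires S) v (fun s => some (f s))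
      Set.subset_union_left
    exact (e1.union (Cost.refl (c := 0))).mono subset_rfl subset_rfl
      (Nat.le_mul_of_pos_right _ (Nat.succ_pos H))
  | halt =>
    refine ⟨0, 0, fun X v S H hS => ⟨.of_subset ?_, hS⟩⟩
    refine Set.union_subset ?_ Set.subset_union_left
    exact (obsWires_const (X := X) (fun a b => b = a) (none : Option Λ)).trans
      Set.subset_union_right

end Stacks

/-! ### Running a machine for a given number of steps -/

section Machines

set_option linter.unusedSectionVars false

variable {X : Type} {A B : Set (X → Prop)} {c : ℕ}

open Turing Computability

variable {K Λ σ : Type} {Γ : K → Type} [DecidableEq K] [Fintype K] [Fintype Λ] [Fintype σ]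

/-- One step of a machine, where a halted machine stays as it is. -/
def advance (m : Λ → TM2.Stmt Γ Λ σ) (C : TM2.Cfg Γ Λ σ) : TM2.Cfg Γ Λ σ :=
  C.l.elim C fun l => TM2.stepAux (m l) C.var C.stk

/-- The statements of all labels are executed in parallel, and the current label selects the result;
the label `none` of a halted machine selects the old configuration. -/
theorem exists_cost_advance (m : Λ → TM2.Stmt Γ Λ σ) (syms : ∀ k, Finset (Γ k))
    (hm : ∀ l, PushesIn syms (m l)) :
    ∃ c b : ℕ, ∀ (X : Type) (C : X → TM2.Cfg Γ Λ σ) (H : ℕ),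
      (∀ x, StackBound syms H (C x).stk) →
        Cost (cfgWires C) (cfgWires fun x => advance m (C x)) (c * (H + 1)) ∧
          ∀ x, StackBound syms (H + b) (advance m (C x)).stk := by
  choose c b h using fun l => exists_cost_stepAux syms (m l) (hm l)
  refine ⟨∑ l, c l + cfgSize Λ σ syms * (2 * Fintype.card (Option Λ)) * (∑ l, b l + 1), ∑ l, b l,
    fun X C H hC => ?_⟩
  have hb : ∀ l, b l ≤ ∑ l, b l := fun l => Finset.single_le_sum (fun _ _ => Nat.zero_le _)
    (Finset.mem_univ l)
  let R : Option Λ → X → TM2.Cfg Γ Λ σ := fun o x =>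
    o.elim (C x) fun l => TM2.stepAux (m l) (C x).var (C x).stk
  have hR : ∀ o x, StackBound syms (H + ∑ l, b l) (R o x).stk := by
    rintro (_ | l) x
    · exact (hC x).mono (Nat.le_add_right _ _)
    · exact ((h l X (fun x => (C x).var) (fun x => (C x).stk) H hC).2 x).mono
        (Nat.add_le_add_left (hb l) _)
  refine ⟨?_, fun x => hR (C x).l x⟩
  have h1 := Cost.biUnion (A := cfgWires C) Finset.univ
    (fun l => cfgWires fun x => TM2.stepAux (m l) (C x).var (C x).stk) _
    fun l _ => (h l X (fun x => (C x).var) (fun x => (C x).stk) H hC).1.mono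
      (Set.subset_union_right) subset_rfl le_rfl
  have h2 := Cost.select_cfg (A := cfgWires C ∪ ⋃ l ∈ Finset.univ,
    cfgWires fun x => TM2.stepAux (m l) (C x).var (C x).stk) (fun x => (C x).l)
    (Set.subset_union_left.trans Set.subset_union_left) R ?_ (H + ∑ l, b l) syms hR
  · refine (h1.trans_union h2).mono subset_rfl subset_rfl ?_
    rw [← Finset.sum_mul, add_mul]
    refine Nat.add_le_add_left ?_ _
    rw [mul_assoc _ (∑ l, b l + 1)]
    exact Nat.mul_le_mul_left _ (by nlinarith [Nat.zero_le ((∑ l, b l) * H)])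
  · rintro (_ | l)
    · exact Set.subset_union_left
    · refine Set.Subset.trans ?_ Set.subset_union_right
      exact Set.subset_biUnion_of_mem (u := fun l => cfgWires fun x =>
        TM2.stepAux (m l) (C x).var (C x).stk) (Finset.mem_coe.2 (Finset.mem_univ l))

theorem exists_cost_iterate_advance (m : Λ → TM2.Stmt Γ Λ σ) (syms : ∀ k, Finset (Γ k))
    (hm : ∀ l, PushesIn syms (m l)) :
    ∃ c b : ℕ, ∀ (X : Type) (C : X → TM2.Cfg Γ Λ σ) (H : ℕ),
      (∀ x, StackBound syms H (C x).stk) → ∀ T : ℕ,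
        Cost (cfgWires C) (cfgWires fun x => (advance m)^[T] (C x)) (T * (c * (H + T * b + 1))) ∧
          ∀ x, StackBound syms (H + T * b) ((advance m)^[T] (C x)).stk := by
  obtain ⟨c, b, h⟩ := exists_cost_advance m syms hm
  refine ⟨c, b, fun X C H hC T => ?_⟩
  induction T with
  | zero => simpa using ⟨Cost.refl, hC⟩
  | succ T ih =>
    obtain ⟨h1, h2⟩ := h X _ _ ih.2
    simp only [Function.iterate_succ_apply']
    refine ⟨(ih.1.trans h1).mono subset_rfl subset_rfl ?_, fun x => (h2 x).mono (by linarith)⟩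
    have e : c * (H + T * b + 1) ≤ c * (H + (T + 1) * b + 1) :=
      Nat.mul_le_mul_left _ (by linarith)
    calc T * (c * (H + T * b + 1)) + c * (H + T * b + 1)
        = (T + 1) * (c * (H + T * b + 1)) := by ring
      _ ≤ _ := Nat.mul_le_mul_left _ e

theorem iterate_advance_of_halted (m : Λ → TM2.Stmt Γ Λ σ) {C : TM2.Cfg Γ Λ σ} (h : C.l = none)
    (T : ℕ) : (advance m)^[T] C = C :=
  Function.iterate_fixed (by simp [advance, h]) T

/-- A circuit must run for the same number of steps on all inputs. Since halted configurations are
fixed by `advance`, running longer than needed does no harm. -/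
theorem iterate_advance_eq (m : Λ → TM2.Stmt Γ Λ σ) {C C' : TM2.Cfg Γ Λ σ} (h : C'.l = none)
    {n T : ℕ} (hn : (flip bind (TM2.step m))^[n] (some C) = some C') (hT : n ≤ T) :
    (advance m)^[T] C = C' := by
  induction n generalizing C T with
  | zero =>
    obtain rfl : C = C' := by simpa using hn
    exact iterate_advance_of_halted m h T
  | succ n ih =>
    obtain ⟨T, rfl⟩ : ∃ T', T = T' + 1 := ⟨T - 1, by omega⟩
    rw [Function.iterate_succ_apply] at hn ⊢
    obtain ⟨_ | l, s, S⟩ := C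
    · have : (flip bind (TM2.step m))^[n] (none : Option (TM2.Cfg Γ Λ σ)) = none :=
        Function.iterate_fixed rfl n
      exact absurd (this.symm.trans hn) (by simp)
    · exact ih hn (by omega)

/-! ### Binary expansions -/

theorem encodeNat_posNum (p : PosNum) : encodeNat (p : ℕ) = encodePosNum p := by
  simp [encodeNat, encodeNum]

theorem encodeNat_zero : encodeNat 0 = [] := rfl

theorem encodeNat_of_ne_zero {n : ℕ} (hn : n ≠ 0) :
    encodeNat n = n.testBit 0 :: encodeNat (n / 2) := by
  obtain ⟨p, rfl⟩ : ∃ p : PosNum, n = p := by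
    rw [← Num.to_of_nat n] at hn ⊢
    cases h : (n : Num) with
    | zero => simp [h] at hn
    | pos p => exact ⟨p, rfl⟩
  rw [encodeNat_posNum]
  cases p with
  | one => rfl
  | bit0 p =>
    have : ((p.bit0 : PosNum) : ℕ) = 2 * (p : ℕ) := by rw [PosNum.cast_bit0]; ring
    rw [this, Nat.mul_div_cancel_left _ two_pos, encodeNat_posNum]
    simp [encodePosNum]
  | bit1 p =>
    have : ((p.bit1 : PosNum) : ℕ) = 2 * (p : ℕ) + 1 := by rw [PosNum.cast_bit1]; ring
    have h2 : (2 * (p : ℕ) + 1) / 2 = p := by omega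
    rw [this, h2, encodeNat_posNum]
    simp [encodePosNum]

theorem length_encodeNat_le_iff {n M : ℕ} : (encodeNat n).length ≤ M ↔ n < 2 ^ M := by
  induction M generalizing n with
  | zero =>
    rcases eq_or_ne n 0 with rfl | hn
    · simp [encodeNat_zero]
    · simp [encodeNat_of_ne_zero hn, hn]
  | succ M ih =>
    rcases eq_or_ne n 0 with rfl | hn
    · simp [encodeNat_zero]
    · rw [encodeNat_of_ne_zero hn, List.length_cons, Nat.succ_le_succ_iff, ih, pow_succ]
      omega

theorem testBit_iff_encodeNat {n i : ℕ} : n.testBit i = true ↔ (encodeNat n)[i]? = some true := by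
  induction i generalizing n with
  | zero =>
    rcases eq_or_ne n 0 with rfl | hn
    · simp [encodeNat_zero]
    · simp [encodeNat_of_ne_zero hn]
  | succ i ih =>
    rcases eq_or_ne n 0 with rfl | hn
    · simp [encodeNat_zero]
    · rw [encodeNat_of_ne_zero hn, Nat.testBit_succ, ih]
      simp

/-! ### Writing the input word from binary digits -/

/-- The predicates on `X` saying what the binary digits of `a` are. -/
abbrev bits (a : X → ℕ) : Set (X → Prop) := obsWires (fun i n => n.testBit i = true) a

theorem bits_div_two (a : X → ℕ) : bits (fun x => a x / 2) ⊆ bits a := by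
  rintro _ ⟨i, rfl⟩
  exact ⟨i + 1, by simp [Nat.testBit_succ]⟩

theorem Cost.hot_prop {p : X → Prop} (hp : p ∈ A) : Cost A (hot p) 1 := by
  refine (Cost.refl.union (Cost.not hp)).mono (c := 0 + 1) subset_rfl ?_ le_rfl
  rintro _ ⟨b, rfl⟩
  by_cases hb : b
  · exact .inl (by simpa [hb] using hp)
  · exact .inr (by simp [hb])

theorem Cost.hot_bool {p : X → Bool} (hp : (fun x => p x = true) ∈ A) :
    Cost A (hot p) 1 := by
  refine (Cost.refl.union (Cost.not hp)).mono (c := 0 + 1) subset_rfl ?_ le_rfl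
  rintro _ ⟨b, rfl⟩
  cases b
  · exact .inr (by simp)
  · exact .inl hp

theorem hot_some {α : Type} (h : X → α) : hot (fun x => some (h x)) ⊆ hot h ∪ constPreds X := by
  rintro _ ⟨o, rfl⟩
  cases o with
  | none => exact .inr ⟨False, by simp⟩
  | some a => exact .inl ⟨a, by simp⟩

theorem Cost.with_consts : Cost A (A ∪ constPreds X) c := .of_subset subset_rfl

theorem eq_zero_iff_testBit_zero_and (n : ℕ) : n = 0 ↔ ¬ n.testBit 0 = true ∧ n / 2 = 0 := by
  rw [Nat.testBit_zero, decide_eq_true_iff]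
  omega

theorem Cost.encodeNat_append (M H : ℕ) (a : X → ℕ) (ha : ∀ x, a x < 2 ^ M)
    (R : X → List (Option Bool)) (hR : ∀ x, (R x).length + M ≤ H) :
    Cost (bits a ∪ cells R)
      (cells (fun x => (encodeNat (a x)).map some ++ R x) ∪ {fun x => a x = 0})
      (M * (16 * H + 6)) := by
  induction M generalizing a with
  | zero =>
    have ha : ∀ x, a x = 0 := fun x => by simpa using ha x
    refine .of_subset (Set.union_subset ?_ ?_)
    · simp only [ha, encodeNat_zero, List.map_nil, List.nil_append]
      exact fun p hp => .inl (.inr hp)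
    · rintro _ rfl
      exact .inr ⟨True, by simp [ha]⟩
  | succ M ih =>
    have ih := ih (fun x => a x / 2) (fun x => by have := ha x; rw [pow_succ] at this; omega)
      fun x => by have := hR x; omega
    set E := fun x => (encodeNat (a x / 2)).map some ++ R x with hE
    set V := (bits a ∪ cells R) ∪ (cells E ∪ {fun x => a x / 2 = 0}) with hV
    have h1 : Cost (bits a ∪ cells R) V (M * (16 * H + 6)) :=
      (Cost.refl (c := 0)).union (ih.mono (Set.union_subset_union_left _ (bits_div_two a))
        subset_rfl le_rfl) |>.mono subset_rfl subset_rfl (by omega)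
    have hb : (fun x => (a x).testBit 0 = true) ∈ V := .inl (.inl ⟨0, rfl⟩)
    have hz : (fun x => a x / 2 = 0) ∈ V := .inr (.inr rfl)
    have h2 : Cost V {fun x => a x = 0} 2 := by
      refine (Cost.trans_union (Cost.not hb) (Cost.and (.inr rfl) (.inl hz))).mono
        subset_rfl ?_ le_rfl
      simp only [Set.singleton_subset_iff, Set.mem_singleton_iff]
      exact funext fun x => propext (eq_zero_iff_testBit_zero_and _)
    have h3 : Cost (V ∪ {fun x => a x = 0}) (hot (fun x => a x = 0)) 1 := Cost.hot_prop (.inr rfl)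
    have h4 : Cost V (cells (fun x => some ((a x).testBit 0) :: E x)) 1 := by
      have e1 : Cost V (hot fun x => (a x).testBit 0) 1 := Cost.hot_bool hb
      have e2 : Cost (V ∪ hot fun x => (a x).testBit 0)
          (cells (fun x => some ((a x).testBit 0) :: E x)) 0 := by
        refine .of_subset ((cells_cons _ _).trans ?_)
        rintro p ((hp | hp) | hp)
        · exact (hot_some _ hp).imp .inr id
        · exact .inl (.inl (.inr (.inl hp)))
        · exact .inr hp
      exact e1.trans_union e2
    -- If `a x = 0`, then `a x / 2 = 0` as well, so `E x` is just `R x`, which is the right word.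
    let Q : Prop → X → List (Option Bool) := fun z x => open Classical in
      if z then E x else some ((a x).testBit 0) :: E x
    have hlen : ∀ x, (E x).length + 1 ≤ H := fun x => by
      have e := hR x
      have : (encodeNat (a x / 2)).length ≤ M :=
        length_encodeNat_le_iff.2 (by have := ha x; rw [pow_succ] at this; omega)
      simp only [hE, List.length_append, List.length_map]
      omega
    have h5 := Cost.select_cells (A := V ∪ ({fun x => a x = 0} ∪
      (hot (fun x => a x = 0) ∪ cells (fun x => some ((a x).testBit 0) :: E x))))
      (fun x => a x = 0) (fun p hp => .inr (.inr (.inl hp))) Q ?_ H Finset.univ ?_ (by simp)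
    · have h6 : Cost V ({fun x => a x = 0} ∪
          (hot (fun x => a x = 0) ∪ cells (fun x => some ((a x).testBit 0) :: E x))) 6 :=
        (h2.union ((h2.trans_union h3).union h4)).mono subset_rfl subset_rfl (by omega)
      have h7 := h1.trans (((Cost.refl (c := 0)).union h6).trans
        (h5.union (Cost.refl (c := 0) |>.mono subset_rfl
          (Set.singleton_subset_iff.2 (.inr (.inl rfl))) le_rfl)))
      refine h7.mono subset_rfl (Set.union_subset_union_left _ (Eq.subset ?_)) ?_
      · congr 1
        funext x
        by_cases hx : a x = 0
        · simp [Q, hx, hE, encodeNat_zero]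
        · simp [Q, hx, hE, encodeNat_of_ne_zero hx]
      · simp
        ring_nf
        omega
    · intro z
      by_cases hz : z
      · simp only [Q, hz, if_true]
        exact fun p hp => .inl (.inr (.inl hp))
      · simp only [Q, hz, if_false]
        exact fun p hp => .inr (.inr (.inr hp))
    · intro z x
      by_cases hz : z
      · simpa [Q, hz] using (Nat.le_succ _).trans (hlen x)
      · simpa [Q, hz] using hlen x

theorem encodeArgs_succ {k : ℕ} (v : Fin (k + 1) → ℕ) :
    encodeArgs v = (encodeNat (v 0)).map some ++ none :: encodeArgs (Fin.tail v) := by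
  simp [encodeArgs, List.ofFn_succ, Fin.tail_def]

theorem length_encodeArgs_le {k M : ℕ} (v : Fin k → ℕ) (hv : ∀ j, v j < 2 ^ M) :
    (encodeArgs v).length ≤ k * (M + 1) := by
  induction k with
  | zero => simp [encodeArgs]
  | succ k ih =>
    have h1 := ih (Fin.tail v) fun j => hv j.succ
    have h2 := length_encodeNat_le_iff.2 (hv 0)
    simp only [encodeArgs_succ, List.length_append, List.length_map, List.length_cons]
    linarith

theorem Cost.encodeArgs {k : ℕ} (M H : ℕ) (a : Fin k → X → ℕ) (ha : ∀ j x, a j x < 2 ^ M)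
    (hH : k * (M + 1) ≤ H) :
    Cost (⋃ j, bits (a j)) (cells fun x => encodeArgs fun j => a j x)
      (k * (M * (16 * H + 6))) := by
  induction k with
  | zero =>
    have : (fun x => PVFactor.encodeArgs fun j => a j x) = fun _ : X => [] := by
      funext x
      simp [PVFactor.encodeArgs]
    rw [this]
    exact .of_subset ((obsWires_const _ _).trans Set.subset_union_right)
  | succ k ih =>
    rw [add_mul] at hH
    have h1 := ih (fun j => a j.succ) (fun j => ha j.succ) (by omega)
    set L := fun x => PVFactor.encodeArgs fun j => a j.succ x with hL
    have h2 := Cost.encodeNat_append M H (a 0) (ha 0) (fun x => none :: L x) fun x => by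
      have := length_encodeArgs_le (fun j : Fin k => a j.succ x) fun j => ha j.succ x
      simp only [hL, List.length_cons]
      omega
    have h3 : Cost (bits (a 0) ∪ cells L) (bits (a 0) ∪ cells fun x => none :: L x) 0 := by
      refine .of_subset (Set.union_subset (fun p hp => .inl (.inl hp)) ((cells_cons _ _).trans ?_))
      rintro p ((hp | hp) | hp)
      · exact .inr (obsWires_const _ _ hp)
      · exact .inl (.inr hp)
      · exact .inr hp
    have h4 : Cost (⋃ j, bits (a j)) (bits (a 0)) 0 :=
      Cost.refl.mono subset_rfl (Set.subset_iUnion (fun j => bits (a j)) 0) le_rfl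
    have h5 : Cost (⋃ j, bits (a j)) (cells L) (k * (M * (16 * H + 6))) :=
      h1.mono (Set.iUnion_subset fun j => Set.subset_iUnion (fun j => bits (a j)) j.succ)
        subset_rfl le_rfl
    refine (((h4.union h5).trans h3).trans h2).mono subset_rfl ?_ (by linarith)
    simp only [encodeArgs_succ]
    exact Set.subset_union_left

/-! ### Circuits for polynomial-time functions -/

theorem eval_mono (P : Polynomial ℕ) {m n : ℕ} (h : m ≤ n) : P.eval m ≤ P.eval n := by
  rw [Polynomial.eval_eq_sum, Polynomial.eval_eq_sum]
  exact Finset.sum_le_sum fun i _ => Nat.mul_le_mul_left _ (Nat.pow_le_pow_left h i)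

/-- Polynomial-time functions have circuits of polynomial size. -/
theorem PolyTime.exists_cost {k : ℕ} {g : (Fin k → ℕ) → ℕ} (hg : PolyTime g) :
    ∃ Q : Polynomial ℕ, ∀ (X : Type) (M : ℕ) (a : Fin k → X → ℕ), (∀ j x, a j x < 2 ^ M) →
      Cost (⋃ j, bits (a j)) (bits fun x => g fun j => a j x) (Q.eval M) ∧
        ∀ x, g (fun j => a j x) < 2 ^ Q.eval M := by
  classical
  obtain ⟨⟨⟨tm, e₀, e₁⟩, time, hout⟩⟩ := hg
  have := tm.kFin
  have := tm.ΛFin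
  have := tm.σFin
  have := tm.Γk₀Fin
  choose s hs using fun l => exists_pushesIn (tm.m l)
  -- The input stack can initially hold any symbol of its finite alphabet; the other stacks only
  -- ever hold pushed symbols.
  let syms : ∀ k, Finset (tm.Γ k) :=
    Function.update (fun k => Finset.univ.biUnion fun l => s l k) tm.k₀ Finset.univ
  have hsyms : ∀ l, PushesIn syms (tm.m l) := fun l => (hs l).mono fun k => by
    by_cases hk : k = tm.k₀
    · subst hk; simp [syms]
    · simp only [syms, Function.update_of_ne hk]
      exact Finset.subset_biUnion_of_mem (fun l => s l k) (Finset.mem_univ l)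
  obtain ⟨c, b, hcb⟩ := exists_cost_iterate_advance tm.m syms hsyms
  let len : Polynomial ℕ := Polynomial.C k * (Polynomial.X + 1)
  let T : Polynomial ℕ := time.comp len
  -- The summands pay for writing the input word, for running the machine, and for the length of the
  -- output, which is at most the final stack height.
  refine ⟨Polynomial.C k * (Polynomial.X * (16 * len + 6)) +
    T * (Polynomial.C c * (len + T * Polynomial.C b + 1)) + (len + T * Polynomial.C b),
    fun X M a ha => ?_⟩
  have hlen : len.eval M = k * (M + 1) := by simp [len]
  set H := k * (M + 1) with hH
  have hT : T.eval M = time.eval H := by simp only [T, Polynomial.eval_comp, hlen]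
  let w : X → List (tm.Γ tm.k₀) := fun x => (encodeArgs fun j => a j x).map e₀.symm
  have hw : ∀ x, (w x).length ≤ H := fun x => by
    simpa [w] using length_encodeArgs_le _ fun j => ha j x
  have hbound : ∀ x, StackBound syms H (initList tm (w x)).stk := by
    intro x k
    by_cases hk : k = tm.k₀
    · subst hk
      simpa [initList, syms] using hw x
    · simp [initList, hk]
  obtain ⟨h2, h3⟩ := hcb X (fun x => initList tm (w x)) H hbound (time.eval H)
  have hrun : ∀ x, (advance tm.m)^[time.eval H] (initList tm (w x)) =
      haltList tm ((encodeNat (g fun j => a j x)).map e₁.symm) := by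
    intro x
    obtain ⟨⟨n, hn⟩, hnT⟩ := hout fun j => a j x
    refine iterate_advance_eq tm.m rfl hn (hnT.trans (eval_mono _ ?_))
    exact length_encodeArgs_le _ fun j => ha j x
  simp only [hrun] at h2 h3
  have hk₁ : ∀ l, (haltList tm l).stk tm.k₁ = l := fun l => by simp [haltList]
  have h1 : Cost (⋃ j, bits (a j)) (cfgWires fun x => initList tm (w x))
      (k * (M * (16 * H + 6))) := by
    refine ((Cost.encodeArgs M H a ha le_rfl).trans
      (Cost.of_subset (c := 0) ?_)).mono subset_rfl subset_rfl (by simp)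
    refine Set.union_subset ?_ (Set.union_subset ?_ (Set.iUnion_subset fun k => ?_))
    · exact (obsWires_const _ _).trans Set.subset_union_right
    · exact (obsWires_const _ _).trans Set.subset_union_right
    · by_cases hk : k = tm.k₀
      · subst hk
        have : (fun x => (initList tm (w x)).stk tm.k₀) = w := by funext x; simp [initList]
        rw [this]
        exact (cells_map e₀.symm _).trans Set.subset_union_left
      · have : (fun x => (initList tm (w x)).stk k) = fun _ => [] := by
          funext x; simp [initList, hk]
        rw [this]
        exact (obsWires_const _ _).trans Set.subset_union_right
  have h4 : bits (fun x => g fun j => a j x) ⊆ cfgWires fun x =>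
      haltList tm ((encodeNat (g fun j => a j x)).map e₁.symm) := by
    rintro _ ⟨i, rfl⟩
    refine .inr (.inr (cells_subset_stackWires _ tm.k₁
      ⟨(i, some (e₁.symm true)), funext fun x => propext ?_⟩))
    simp only [hk₁, testBit_iff_encodeNat]
    cases h : (encodeNat (g fun j => a j x))[i]? <;> simp [h]
  refine ⟨(h1.trans h2).mono subset_rfl h4 ?_, fun x => ?_⟩
  · simp [hlen, hT]
  · rw [← length_encodeNat_le_iff]
    have h5 := (h3 x tm.k₁).1
    rw [hk₁, List.length_map] at h5
    refine h5.trans ?_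
    simp [hlen, hT]

end Machines

/-! ### Circuits for arithmetic -/

section Arithmetic

variable {X : Type} {A B : Set (X → Prop)} {c : ℕ}

/-- A truth table on one-hot codes: 3 negations, 4 + 8 gates for pairs and triples, and at most `8 *
8` for the table. -/
theorem Cost.bool_fun {p q r : X → Bool} (hp : (fun x => p x = true) ∈ A)
    (hq : (fun x => q x = true) ∈ A) (hr : (fun x => r x = true) ∈ A)
    (φ : Bool → Bool → Bool → Bool) :
    Cost A {fun x => φ (p x) (q x) (r x) = true} 79 := by
  have h1 := (Cost.hot_bool hp).union ((Cost.hot_bool hq).union (Cost.hot_bool hr))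
  have h2 := Cost.pair_hot (A := hot p ∪ (hot q ∪ hot r)) q r Finset.univ Finset.univ (by simp)
    (by simp) (fun p hp => .inr (.inl hp)) (fun p hp => .inr (.inr hp))
  have h3 := Cost.pair_hot (A := (hot p ∪ (hot q ∪ hot r)) ∪ hot fun x => (q x, r x)) p
    (fun x => (q x, r x)) Finset.univ Finset.univ (by simp) (by simp)
    (fun p hp => .inl (.inl hp)) (fun p hp => .inr hp)
  have h4 := Cost.comp_hot (fun x => (p x, q x, r x)) (fun t => φ t.1 t.2.1 t.2.2) Finset.univ
    (by simp) subset_rfl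
  refine (h1.trans ((h2.trans_union h3).trans h4)).mono subset_rfl ?_ (by simp)
  rintro _ rfl
  exact ⟨true, rfl⟩

/-- Ripple-carry addition: each position needs the majority for the next carry and the parity for
the digit, that is `2 * 79` gates. -/
theorem Cost.add_mod (a b : X → ℕ) (M : ℕ) (hA : bits a ⊆ A) (hB : bits b ⊆ A) :
    Cost A (bits fun x => (a x + b x) % 2 ^ M) (M * 158) := by
  let u : X → BitVec M := fun x => BitVec.ofNat M (a x)
  let w : X → BitVec M := fun x => BitVec.ofNat M (b x)
  have hu : ∀ i < M, (fun x => (u x).getLsbD i = true) ∈ A := fun i hi =>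
    hA ⟨i, by simp only [u, BitVec.getLsbD_ofNat, hi, decide_true, Bool.true_and]⟩
  have hw : ∀ i < M, (fun x => (w x).getLsbD i = true) ∈ A := fun i hi =>
    hB ⟨i, by simp only [w, BitVec.getLsbD_ofNat, hi, decide_true, Bool.true_and]⟩
  have hsum : ∀ x, (a x + b x) % 2 ^ M = (u x + w x).toNat := fun x => by
    simp [u, w, BitVec.toNat_add]
  have key : ∀ j ≤ M, Cost A ({fun x => BitVec.carry j (u x) (w x) false = true} ∪
      {p | ∃ i < j, p = fun x => (u x + w x).getLsbD i = true}) (j * 158) := by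
    intro j
    induction j with
    | zero =>
      refine fun _ => .of_subset (Set.union_subset ?_ ?_)
      · rintro _ rfl
        exact .inr ⟨False, by simp⟩
      · simp
    | succ j ih =>
      intro hj
      have hj' : j < M := hj
      refine (Cost.trans_union (ih hj'.le) (B := _)
        (((Cost.bool_fun (p := fun x => (u x).getLsbD j) (q := fun x => (w x).getLsbD j)
          (r := fun x => BitVec.carry j (u x) (w x) false) (.inl (hu j hj')) (.inl (hw j hj'))
          (.inr (.inl rfl)) Bool.atLeastTwo).union
          (Cost.bool_fun (p := fun x => (u x).getLsbD j) (q := fun x => (w x).getLsbD j)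
          (r := fun x => BitVec.carry j (u x) (w x) false) (.inl (hu j hj')) (.inl (hw j hj'))
          (.inr (.inl rfl)) fun p q r => p ^^ (q ^^ r))).union
          ((Cost.refl (c := 0)).mono subset_rfl
            (Set.subset_union_right.trans Set.subset_union_right) le_rfl))).mono
        subset_rfl ?_ (by ring_nf; rfl)
      refine Set.union_subset ?_ ?_
      · rintro _ rfl
        refine .inl (.inl ?_)
        simp only [BitVec.carry_succ, Set.mem_singleton_iff]
      · rintro _ ⟨i, hi, rfl⟩
        rcases Nat.lt_succ_iff_lt_or_eq.1 hi with hi | rfl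
        · exact .inr ⟨i, hi, rfl⟩
        · refine .inl (.inr ?_)
          simp only [BitVec.getLsbD_add hj', Set.mem_singleton_iff]
  refine (key M le_rfl).trans (Cost.of_subset (c := 0) ?_)
  rintro _ ⟨i, rfl⟩
  simp only [hsum]
  by_cases hi : i < M
  · exact .inl (.inr ⟨i, hi, rfl⟩)
  · refine .inr ⟨False, funext fun x => ?_⟩
    have : (u x + w x).toNat.testBit i = false := BitVec.getLsbD_of_ge _ _ (not_lt.1 hi)
    rw [this]
    simp

theorem mod_two_pow_succ (n j : ℕ) :
    n % 2 ^ (j + 1) = n % 2 ^ j + 2 ^ j * (n.testBit j).toNat := by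
  rw [Nat.mod_pow_succ, Nat.toNat_testBit]

theorem bits_mul_two_pow (a : X → ℕ) (j : ℕ) :
    bits (fun x => a x * 2 ^ j) ⊆ bits a ∪ constPreds X := by
  rintro _ ⟨i, rfl⟩
  by_cases hj : j ≤ i
  · exact .inl ⟨i - j, by simp [← Nat.shiftLeft_eq, hj]⟩
  · exact .inr ⟨False, by simp [← Nat.shiftLeft_eq, hj]⟩

/-- Shift and add along the digits of the constant `d`; shifts cost nothing, so there is one
addition for each digit. -/
theorem Cost.mul_const_mod (a : X → ℕ) (d M : ℕ) :
    Cost (bits a) (bits fun x => (a x * d) % 2 ^ M) (M * (M * 158)) := by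
  have key : ∀ j : ℕ, Cost (bits a) (bits fun x => (a x * (d % 2 ^ j)) % 2 ^ M)
      (j * (M * 158)) := by
    intro j
    induction j with
    | zero =>
      simp only [pow_zero, Nat.mod_one, mul_zero, Nat.zero_mod]
      exact .of_subset ((obsWires_const _ 0).trans Set.subset_union_right)
    | succ j ih =>
      have h1 := Cost.add_mod (A := (bits a ∪ bits fun x => (a x * (d % 2 ^ j)) % 2 ^ M) ∪
        constPreds X) (fun x => (a x * (d % 2 ^ j)) % 2 ^ M)
        (fun x => a x * 2 ^ j * (d.testBit j).toNat) M (fun p hp => .inl (.inr hp)) ?_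
      · refine (ih.trans_union (Cost.with_consts.trans h1)).mono
          (c := j * (M * 158) + (0 + M * 158)) (d := (j + 1) * (M * 158)) subset_rfl
          (Eq.subset ?_) (by ring_nf; rfl)
        congr 1
        funext x
        rw [mod_two_pow_succ, Nat.mod_add_mod]
        congr 1
        ring
      · cases d.testBit j
        · simp only [Bool.toNat_false, mul_zero]
          exact (obsWires_const _ 0).trans Set.subset_union_right
        · simp only [Bool.toNat_true, mul_one]
          exact (bits_mul_two_pow a j).trans (Set.union_subset_union_left _ Set.subset_union_left)
  have e : ∀ x, (a x * d) % 2 ^ M = (a x * (d % 2 ^ M)) % 2 ^ M := fun x => by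
    simp [Nat.mul_mod]
  simp only [e]
  exact key M

theorem Cost.mul_const (a : X → ℕ) (d M : ℕ) (h : ∀ x, a x * d < 2 ^ M) :
    Cost (bits a) (bits fun x => a x * d) (M * (M * 158)) := by
  have := Cost.mul_const_mod a d M
  simpa only [Nat.mod_eq_of_lt (h _)] using this

end Arithmetic

/-! ### Circuits from cost bounds -/

section Circuits

variable {X : Type} {m : ℕ}

theorem Gates.wires_snoc_last {s : ℕ} (x : Fin m → Bool) (G : Gates m s) (g : Gate (m + s)) :
    (Gates.snoc G g).wires x (Fin.last (m + s)) = g.eval (G.wires x) :=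
  Fin.snoc_last (n := m + s) (α := fun _ => Bool) _ _

theorem Gates.wires_snoc_castSucc {s : ℕ} (x : Fin m → Bool) (G : Gates m s) (g : Gate (m + s))
    (i : Fin (m + s)) :
    (Gates.snoc G g).wires x (Fin.castSucc (n := m + s) i) = G.wires x i :=
  Fin.snoc_castSucc (n := m + s) (α := fun _ => Bool) _ _ i

/-- The two additional gates supply the constants, which `Build` has for free. -/
theorem Build.exists_gates (inp : X → Fin m → Bool) {c : ℕ} {W : Set (X → Prop)}
    (h : Build ({p | ∃ i, p = fun x => inp x i = true} ∪ constPreds X) c W) :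
    ∃ G : Gates m (c + 2), ∀ p ∈ W, ∃ i, ∀ x, G.wires (inp x) i = true ↔ p x := by
  induction h with
  | nil =>
    refine ⟨.snoc (.snoc .nil (.const false)) (.const true), ?_⟩
    rintro p (⟨i, rfl⟩ | ⟨b, rfl⟩)
    · refine ⟨Fin.castSucc (n := m + 1) (Fin.castSucc (n := m) i), fun x => ?_⟩
      erw [Gates.wires_snoc_castSucc (s := 1), Gates.wires_snoc_castSucc (s := 0)]
      rfl
    · by_cases hb : b
      · refine ⟨Fin.last (m + 1), fun x => ?_⟩
        erw [Gates.wires_snoc_last (s := 1)]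
        simp [Gate.eval, hb]
      · refine ⟨Fin.castSucc (n := m + 1) (Fin.last m), fun x => ?_⟩
        erw [Gates.wires_snoc_castSucc (s := 1), Gates.wires_snoc_last (s := 0)]
        simp [Gate.eval, hb]
  | @gate c W g _ hg ih =>
    obtain ⟨G, hG⟩ := ih
    obtain ⟨e, he⟩ : ∃ e : Gate (m + (c + 2)), ∀ x, e.eval (G.wires (inp x)) = true ↔ g x := by
      cases hg with
      | not hp =>
        obtain ⟨i, hi⟩ := hG _ hp
        exact ⟨.not i, fun x => by simp [Gate.eval, ← hi]⟩
      | and hp hq =>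
        obtain ⟨i, hi⟩ := hG _ hp
        obtain ⟨j, hj⟩ := hG _ hq
        exact ⟨.and i j, fun x => by simp [Gate.eval, ← hi, ← hj]⟩
      | or hp hq =>
        obtain ⟨i, hi⟩ := hG _ hp
        obtain ⟨j, hj⟩ := hG _ hq
        exact ⟨.or i j, fun x => by simp [Gate.eval, ← hi, ← hj]⟩
    refine ⟨.snoc (s := c + 2) G e, ?_⟩
    rintro p (rfl | hp)
    · refine ⟨Fin.last (m + (c + 2)), fun x => ?_⟩
      rw [← he]
      erw [Gates.wires_snoc_last (s := c + 2)]
    · obtain ⟨i, hi⟩ := hG p hp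
      refine ⟨Fin.castSucc (n := m + (c + 2)) i, fun x => ?_⟩
      rw [← hi]
      erw [Gates.wires_snoc_castSucc (s := c + 2)]

theorem sum_testBit_two_pow {k n : ℕ} (h : n < 2 ^ k) :
    (∑ i : Fin k, if n.testBit i then 2 ^ (i : ℕ) else 0) = n := by
  have key : ∀ j : ℕ, (∑ i ∈ Finset.range j, if n.testBit i then 2 ^ i else 0) = n % 2 ^ j := by
    intro j
    induction j with
    | zero => simp [Nat.mod_one]
    | succ j ih =>
      rw [Finset.sum_range_succ, ih, mod_two_pow_succ]
      cases n.testBit j <;> simp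
  rw [Fin.sum_univ_eq_sum_range (fun i => if n.testBit i then 2 ^ i else 0), key,
    Nat.mod_eq_of_lt h]

/-- The circuit is correct only on the inputs `N x`. Taking for `X` a type of favourable inputs thus
builds a promise into the circuit. -/
theorem Cost.exists_circuit {k c : ℕ} {N g : X → ℕ} (h : Cost (bits N) (bits g) c)
    (hN : ∀ x, N x < 2 ^ m) (hg : ∀ x, g x < 2 ^ k) :
    ∃ C : BoolCircuit m k, C.size ≤ c + 2 ∧ ∀ x, C.evalNat (N x) = g x := by
  let inp : X → Fin m → Bool := fun x j => (N x).testBit j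
  have h0 : Cost {p | ∃ i, p = fun x => inp x i = true} (bits N) 0 := by
    refine .of_subset ?_
    rintro _ ⟨i, rfl⟩
    by_cases hi : i < m
    · exact .inl ⟨⟨i, hi⟩, rfl⟩
    · refine .inr ⟨False, funext fun x => ?_⟩
      have := Nat.testBit_eq_false_of_lt
        ((hN x).trans_le (Nat.pow_le_pow_right two_pos (not_lt.1 hi)))
      simp [this]
  obtain ⟨d, hd, W, hW, hgW⟩ := h0.trans h
  obtain ⟨G, hG⟩ := hW.exists_gates inp
  choose o ho using fun i : Fin k => hG _ (hgW ⟨(i : ℕ), rfl⟩)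
  refine ⟨⟨d + 2, G, o⟩, by simpa using hd, fun x => ?_⟩
  rw [← sum_testBit_two_pow (hg x)]
  refine Finset.sum_congr rfl fun i _ => ?_
  have : BoolCircuit.eval ⟨d + 2, G, o⟩ (fun j : Fin m => (N x).testBit j) i =
      (g x).testBit i := Bool.eq_iff_iff.2 (ho i x)
  rw [this]

end Circuits

/-! ### Terms with counterexamples -/

section Terms

/-- Closed terms over the symbols of `L`, a constant `var`, and a unary symbol `cex` standing for a
function that refutes the claim that the value of a term is a prime factor of `var`. -/
inductive GameTerm (L : FirstOrder.Language.{u, v}) : Type u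
  | var : GameTerm L
  | app {k : ℕ} (f : L.Functions k) (a : Fin k → GameTerm L) : GameTerm L
  | cex (t : GameTerm L) : GameTerm L

variable {L : FirstOrder.Language.{u, v}}

namespace GameTerm

/-- The nesting depth of the symbol `cex`. -/
def depth : GameTerm L → ℕ
  | var => 0
  | app _ a => Finset.univ.sup fun i => (a i).depth
  | cex t => t.depth + 1

/-- The number of symbols of a term. -/
def size : GameTerm L → ℕ
  | var => 1
  | app _ a => ∑ i, (a i).size + 1
  | cex t => t.size + 1

end GameTerm

open GameTerm

/-- A set of terms that contains the arguments of its members. -/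
structure IsSubtermClosed (F : Set (GameTerm L)) : Prop where
  app {k : ℕ} (f : L.Functions k) (a : Fin k → GameTerm L) (i : Fin k) : app f a ∈ F → a i ∈ F
  cex (t : GameTerm L) : cex t ∈ F → t ∈ F

theorem IsSubtermClosed.iUnion {I : Type*} {F : I → Set (GameTerm L)}
    (hF : ∀ i, IsSubtermClosed (F i)) : IsSubtermClosed (⋃ i, F i) where
  app f a i h := by
    obtain ⟨j, hj⟩ := Set.mem_iUnion.1 h
    exact Set.mem_iUnion.2 ⟨j, (hF j).app f a i hj⟩
  cex t h := by
    obtain ⟨j, hj⟩ := Set.mem_iUnion.1 h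
    exact Set.mem_iUnion.2 ⟨j, (hF j).cex t hj⟩

theorem exists_finite_subtermClosed (t : GameTerm L) :
    ∃ F : Set (GameTerm L), F.Finite ∧ IsSubtermClosed F ∧ t ∈ F := by
  induction t with
  | var =>
    exact ⟨{.var}, Set.finite_singleton _, ⟨fun _ _ _ h => by simp at h, fun _ h => by simp at h⟩,
      rfl⟩
  | app f a ih =>
    choose F hfin hcl hmem using ih
    refine ⟨insert (.app f a) (⋃ i, F i), (Set.finite_iUnion hfin).insert _, ⟨?_, ?_⟩, .inl rfl⟩
    · rintro k g b i (h | h)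
      · cases h
        exact .inr (Set.mem_iUnion.2 ⟨i, hmem i⟩)
      · exact .inr ((IsSubtermClosed.iUnion hcl).app g b i h)
    · rintro s (h | h)
      · cases h
      · exact .inr ((IsSubtermClosed.iUnion hcl).cex s h)
  | cex t ih =>
    obtain ⟨F, hfin, hcl, hmem⟩ := ih
    refine ⟨insert (.cex t) F, hfin.insert _, ⟨?_, ?_⟩, .inl rfl⟩
    · rintro k g b i (h | h)
      · cases h
      · exact .inr (hcl.app g b i h)
    · rintro s (h | h)
      · cases h
        exact .inr hmem
      · exact .inr (hcl.cex s h)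

theorem exists_subtermClosed_superset (F : Finset (GameTerm L)) :
    ∃ G : Finset (GameTerm L), IsSubtermClosed (G : Set (GameTerm L)) ∧ F ⊆ G := by
  choose G hfin hcl hmem using fun t : GameTerm L => exists_finite_subtermClosed t
  have hf : (⋃ t : F, G t).Finite := Set.finite_iUnion fun t => hfin t
  refine ⟨hf.toFinset, ?_, fun t ht => ?_⟩
  · rw [Set.Finite.coe_toFinset]
    exact IsSubtermClosed.iUnion fun t => hcl t
  · rw [Set.Finite.mem_toFinset]
    exact Set.mem_iUnion.2 ⟨⟨t, ht⟩, hmem t⟩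

/-! ### The value of a term on a product of primes indexed by a cube -/

variable {D : ℕ}

/-- The indices of the factors of `y`, if `y` divides the product of all `p u`. -/
def divs {ι : Type} [Fintype ι] (p : ι → ℕ) (y : ℕ) : Finset ι :=
  if y ∣ ∏ u, p u then Finset.univ.filter (fun u => p u ∣ y) else ∅

/-- The value of a term at the product of all `p u`. If `t` divides it, then the counterexample to
`t` is the product of the factors of `t` in the half of the cube given by the coordinate
`depth t`. -/
def GameTerm.eval [L.Structure ℕ] (p : (Fin D → Bool) → ℕ) : GameTerm L → ℕ
  | var => ∏ u, p u
  | app f a => FirstOrder.Language.Structure.funMap f fun i => (a i).eval p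
  | cex t => ∏ u ∈ divs p (t.eval p) with ∃ i : Fin D, (i : ℕ) = t.depth ∧ u i = false, p u

/-- The points `v` and `w` of the cube have the same first `d` coordinates. -/
def Agree (d : ℕ) (v w : Fin D → Bool) : Prop := ∀ i : Fin D, (i : ℕ) < d → v i = w i

/-- Membership in `A` depends on the first `d` coordinates only. -/
def Nonsep (d : ℕ) (A : Finset (Fin D → Bool)) : Prop :=
  ∀ v w, Agree d v w → (v ∈ A ↔ w ∈ A)

theorem prod_divs {ι : Type} [Fintype ι] {p : ι → ℕ} (hp : ∀ u, (p u).Prime)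
    (hinj : Function.Injective p) {y : ℕ} (hy : y ∣ ∏ u, p u) : ∏ u ∈ divs p y, p u = y := by
  classical
  have hsq : Squarefree (∏ u, p u) := by
    refine Finset.squarefree_prod_of_pairwise_isCoprime ?_ fun u _ => (hp u).squarefree
    intro u _ w _ huw
    exact Nat.coprime_iff_isRelPrime.1 ((Nat.coprime_primes (hp u) (hp w)).2 (hinj.ne huw))
  have hne : y ≠ 0 := fun h => hsq.ne_zero (by simpa [h] using hy)
  have : y.primeFactors = (divs p y).image p := by
    ext q
    simp only [divs, if_pos hy, Finset.mem_image, Finset.mem_filter, Finset.mem_univ, true_and,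
      Nat.mem_primeFactors]
    constructor
    · rintro ⟨hq, hqy, _⟩
      obtain ⟨u, _, hu⟩ := (hq.prime.dvd_finsetProd_iff _).1 (hqy.trans hy)
      have := (Nat.prime_dvd_prime_iff_eq hq (hp u)).1 hu
      exact ⟨u, this ▸ hqy, this.symm⟩
    · rintro ⟨u, hu, rfl⟩
      exact ⟨hp u, hu, hne⟩
  have h := Nat.prod_primeFactors_of_squarefree (hsq.squarefree_of_dvd hy)
  rwa [this, Finset.prod_image hinj.injOn] at h

/-- The index set of the factors is nonempty because the value is at least 2, and it is closed under
changing coordinate `t.depth`. So both halves of it are nonempty, and each contributes a prime. -/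
theorem cex_refutes [L.Structure ℕ] {p : (Fin D → Bool) → ℕ} (hp : ∀ u, (p u).Prime)
    (hinj : Function.Injective p) (t : GameTerm L) (hD : t.depth < D)
    (hsep : Nonsep t.depth (divs p (t.eval p))) (h2 : 2 ≤ t.eval p)
    (hdvd : t.eval p ∣ ∏ u, p u) :
    (GameTerm.cex t).eval p ∣ t.eval p ∧ (GameTerm.cex t).eval p ≠ 1 ∧
      (GameTerm.cex t).eval p ≠ t.eval p := by
  classical
  have hprod := prod_divs hp hinj hdvd
  set A := divs p (t.eval p) with hA
  have hz : (GameTerm.cex t).eval p =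
      ∏ u ∈ A with ∃ i : Fin D, (i : ℕ) = t.depth ∧ u i = false, p u := rfl
  have hset : ∀ b, ∃ u ∈ A, u ⟨t.depth, hD⟩ = b := by
    intro b
    have hne : A.Nonempty := by
      rw [Finset.nonempty_iff_ne_empty]
      intro h
      rw [h, Finset.prod_empty] at hprod
      omega
    obtain ⟨u, hu⟩ := hne
    refine ⟨Function.update u ⟨t.depth, hD⟩ b, (hsep _ _ ?_).1 hu, by simp⟩
    intro i hi
    rw [Function.update_of_ne]
    rintro rfl
    simp at hi
  have hsplit := Finset.prod_filter_mul_prod_filter_not A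
    (fun u => ∃ i : Fin D, (i : ℕ) = t.depth ∧ u i = false) p
  rw [hprod, ← hz] at hsplit
  refine ⟨⟨_, hsplit.symm⟩, fun h1 => ?_, fun h1 => ?_⟩
  · obtain ⟨u, hu, hb⟩ := hset false
    have : p u ∣ (GameTerm.cex t).eval p := by
      rw [hz]
      exact Finset.dvd_prod_of_mem p (Finset.mem_filter.2 ⟨hu, _, rfl, hb⟩)
    rw [h1] at this
    exact (hp u).one_lt.ne' (Nat.dvd_one.1 this)
  · obtain ⟨u, hu, hb⟩ := hset true
    have : p u ∣ ∏ u ∈ A with ¬ ∃ i : Fin D, (i : ℕ) = t.depth ∧ u i = false, p u := by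
      refine Finset.dvd_prod_of_mem p (Finset.mem_filter.2 ⟨hu, ?_⟩)
      rintro ⟨i, hi, hi'⟩
      obtain rfl : i = ⟨t.depth, hD⟩ := Fin.ext hi
      simp [hb] at hi'
    rw [h1] at hsplit
    rw [Nat.eq_of_mul_eq_mul_left (by omega) (hsplit.trans (mul_one _).symm)] at this
    exact (hp u).one_lt.ne' (Nat.dvd_one.1 this)

end Terms

/-! ### Factoring with a separating term -/

section Factoring

/-- Put `a` and `b` at the positions `v` and `w`. -/
def plant {ι : Type} [DecidableEq ι] (v w : ι) (ω : ι → ℕ) (ab : ℕ × ℕ) : ι → ℕ :=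
  Function.update (Function.update ω v ab.1) w ab.2

theorem prod_lt_two_pow {ι : Type} [Fintype ι] {p : ι → ℕ} {n : ℕ}
    (hp : ∀ u, p u < 2 ^ n) (U : Finset ι) : ∏ u ∈ U, p u < 2 ^ (n * Fintype.card ι + 1) := by
  calc ∏ u ∈ U, p u ≤ (2 ^ n) ^ U.card := Finset.prod_le_pow_card _ _ _ fun u _ => (hp u).le
    _ = 2 ^ (n * U.card) := (pow_mul _ _ _).symm
    _ < _ := Nat.pow_lt_pow_right one_lt_two
      (Nat.lt_succ_of_le (Nat.mul_le_mul_left _ (Finset.card_le_univ U)))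

section Plant

variable {ι : Type} [DecidableEq ι] {v w : ι}

theorem plant_left (hvw : v ≠ w) (ω : ι → ℕ) (ab : ℕ × ℕ) : plant v w ω ab v = ab.1 := by
  simp [plant, hvw]

theorem plant_right (ω : ι → ℕ) (ab : ℕ × ℕ) : plant v w ω ab w = ab.2 := by
  simp [plant]

theorem plant_of_ne (ω : ι → ℕ) (ab : ℕ × ℕ) {u : ι} (hv : u ≠ v) (hw : u ≠ w) :
    plant v w ω ab u = ω u := by
  simp [plant, hv, hw]

/-- Exchanging a pair with the entries at `v` and `w` is an involution; this makes planting uniform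
in `exists_card_plant_ge`. -/
theorem plant_plant (hvw : v ≠ w) (ω : ι → ℕ) (ab : ℕ × ℕ) :
    plant v w (plant v w ω ab) (ω v, ω w) = ω := by
  funext u
  by_cases hw : u = w
  · subst hw; rw [plant_right]
  by_cases hv : u = v
  · subst hv; rw [plant_left hvw]
  rw [plant_of_ne _ _ hv hw, plant_of_ne _ _ hv hw]

theorem plant_mem (P : ι → ℕ → Prop) {ω : ι → ℕ} {ab : ℕ × ℕ} (hω : ∀ u, P u (ω u))
    (ha : P v ab.1) (hb : P w ab.2) (u : ι) : P u (plant v w ω ab u) := by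
  by_cases hw : u = w
  · subst hw; rwa [plant_right]
  by_cases hv : u = v
  · subst hv; rwa [plant_left (by exact hw)]
  rw [plant_of_ne _ _ hv hw]
  exact hω u

/-- If `U` contains both points, the product is `a * b` times a constant; if it contains neither, it
is a constant. -/
theorem Cost.prod_plant [Fintype ι] (hvw : v ≠ w) {X : Type} (ab : X → ℕ × ℕ) (ω : ι → ℕ) {n : ℕ}
    (hω : ∀ u, ω u < 2 ^ n) (ha : ∀ x, (ab x).1 < 2 ^ n) (hb : ∀ x, (ab x).2 < 2 ^ n)
    (U : Finset ι) (hU : v ∈ U ↔ w ∈ U) {M : ℕ} (hM : M = n * Fintype.card ι + 1) :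
    Cost (bits fun x => (ab x).1 * (ab x).2) (bits fun x => ∏ u ∈ U, plant v w ω (ab x) u)
      (M * (M * 158)) := by
  by_cases hv : v ∈ U
  · have hw : w ∈ U.erase v := Finset.mem_erase.2 ⟨hvw.symm, hU.1 hv⟩
    have h : ∀ x, ∏ u ∈ U, plant v w ω (ab x) u =
        (ab x).1 * (ab x).2 * ∏ u ∈ (U.erase v).erase w, ω u := by
      intro x
      rw [← Finset.mul_prod_erase U _ hv, ← Finset.mul_prod_erase _ _ hw, plant_left hvw,
        plant_right, mul_assoc]
      congr 2
      refine Finset.prod_congr rfl fun u hu => ?_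
      simp only [Finset.mem_erase] at hu
      exact plant_of_ne _ _ hu.2.1 hu.1
    have hlt : ∀ x, ∏ u ∈ U, plant v w ω (ab x) u < 2 ^ M := fun x => hM ▸
      prod_lt_two_pow (plant_mem (fun _ y => y < 2 ^ n) hω (ha x) (hb x)) U
    simp only [h] at hlt ⊢
    exact Cost.mul_const _ _ M hlt
  · have h : ∀ x, ∏ u ∈ U, plant v w ω (ab x) u = ∏ u ∈ U, ω u := by
      refine fun x => Finset.prod_congr rfl fun u hu => plant_of_ne _ _ ?_ ?_
      · rintro rfl; exact hv hu
      · rintro rfl; exact hv (hU.2 hu)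
    simp only [h]
    exact .of_subset ((obsWires_const _ _).trans Set.subset_union_right)

end Plant

open GameTerm

variable {L : FirstOrder.Language.{u, v}} [L.Structure ℕ] {D : ℕ}

/-- As long as the terms below `t` do not separate `v` from `w`, their values on tuples with a
fixed pattern of divisibilities can be computed from the product of the entries at `v` and `w`. -/
theorem exists_cost_eval (hL : IsPV L) {F : Set (GameTerm L)} (hF : IsSubtermClosed F)
    (A : GameTerm L → Finset (Fin D → Bool)) {v w : Fin D → Bool} (hvw : v ≠ w) (t : GameTerm L)
    (hagree : Agree t.depth v w)
    (hA : ∀ s ∈ F, s.size < t.size → s.depth ≤ t.depth → (v ∈ A s ↔ w ∈ A s))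
    (s : GameTerm L) (hs : s ∈ F) (hsize : s.size ≤ t.size) (hdepth : s.depth ≤ t.depth) :
    ∃ Q : Polynomial ℕ, ∀ (n : ℕ) (X : Type) (ab : X → ℕ × ℕ) (ω : (Fin D → Bool) → ℕ),
      (∀ u, ω u < 2 ^ n) → (∀ x, (ab x).1 < 2 ^ n) → (∀ x, (ab x).2 < 2 ^ n) →
      (∀ x, ∀ s ∈ F, divs (plant v w ω (ab x)) (s.eval (plant v w ω (ab x))) = A s) →
        Cost (bits fun x => (ab x).1 * (ab x).2) (bits fun x => s.eval (plant v w ω (ab x)))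
          (Q.eval n) ∧ ∀ x, s.eval (plant v w ω (ab x)) < 2 ^ Q.eval n := by
  have hprod : ∀ U : Finset (Fin D → Bool), (v ∈ U ↔ w ∈ U) →
      ∃ Q : Polynomial ℕ, ∀ (n : ℕ) (X : Type) (ab : X → ℕ × ℕ) (ω : (Fin D → Bool) → ℕ),
      (∀ u, ω u < 2 ^ n) → (∀ x, (ab x).1 < 2 ^ n) → (∀ x, (ab x).2 < 2 ^ n) →
        Cost (bits fun x => (ab x).1 * (ab x).2) (bits fun x => ∏ u ∈ U, plant v w ω (ab x) u)
          (Q.eval n) ∧ ∀ x, ∏ u ∈ U, plant v w ω (ab x) u < 2 ^ Q.eval n := by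
    intro U hU
    let M : Polynomial ℕ := Polynomial.X * Polynomial.C (Fintype.card (Fin D → Bool)) + 1
    refine ⟨M * (M * 158) + M, fun n X ab ω hω ha hb => ?_⟩
    have hM : M.eval n = n * Fintype.card (Fin D → Bool) + 1 := by simp [M]
    refine ⟨(Cost.prod_plant hvw ab ω hω ha hb U hU hM).mono subset_rfl subset_rfl (by simp),
      fun x => ?_⟩
    refine (prod_lt_two_pow (plant_mem (fun _ y => y < 2 ^ n) hω (ha x) (hb x)) U).trans_le ?_
    exact Nat.pow_le_pow_right two_pos (by rw [← hM]; simp)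
  induction s with
  | var =>
    obtain ⟨Q, hQ⟩ := hprod Finset.univ (by simp)
    exact ⟨Q, fun n X ab ω hω ha hb _ => hQ n X ab ω hω ha hb⟩
  | @app k f a ih =>
    have hsz : ∀ i, (a i).size ≤ ∑ i, (a i).size := fun i =>
      Finset.single_le_sum (f := fun i => (a i).size) (fun _ _ => Nat.zero_le _)
        (Finset.mem_univ i)
    have hdp : ∀ i, (a i).depth ≤ (GameTerm.app f a).depth := fun i =>
      Finset.le_sup (f := fun i => (a i).depth) (Finset.mem_univ i)
    choose Q hQ using fun i => ih i (hF.app f a i hs)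
      ((hsz i).trans ((Nat.le_succ _).trans hsize)) ((hdp i).trans hdepth)
    obtain ⟨R, hR⟩ := (hL.polyTime k f).exists_cost
    refine ⟨∑ i, Q i + R.comp (∑ i, Q i), fun n X ab ω hω ha hb hpat => ?_⟩
    have hle : ∀ i, (Q i).eval n ≤ (∑ i, Q i).eval n := fun i => by
      rw [Polynomial.eval_finsetSum]
      exact Finset.single_le_sum (f := fun i => (Q i).eval n) (fun _ _ => Nat.zero_le _)
        (Finset.mem_univ i)
    obtain ⟨h1, h2⟩ := hR X ((∑ i, Q i).eval n) (fun i x => (a i).eval (plant v w ω (ab x)))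
      fun i x => ((hQ i n X ab ω hω ha hb hpat).2 x).trans_le
        (Nat.pow_le_pow_right two_pos (hle i))
    have h3 := Cost.biUnion Finset.univ (fun i => bits fun x => (a i).eval (plant v w ω (ab x)))
      (fun i => (Q i).eval n) fun i _ => (hQ i n X ab ω hω ha hb hpat).1
    constructor
    · refine ((h3.mono subset_rfl (by simp) le_rfl).trans h1).mono subset_rfl subset_rfl ?_
      simp [Polynomial.eval_finsetSum]
    · refine fun x => (h2 x).trans_le (Nat.pow_le_pow_right two_pos ?_)
      simp
  | cex r ih =>
    have hr := hF.cex r hs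
    have hlt : r.depth < t.depth := hdepth
    -- The answer to `r` is a product over the part of `A r` given by coordinate `r.depth`. By
    -- minimality `A r` does not separate the two points, and they agree at that coordinate because
    -- it is below `t.depth`.
    have hiff := hA r hr hsize hlt.le
    obtain ⟨Q, hQ⟩ := hprod
      ((A r).filter fun u => ∃ i : Fin D, (i : ℕ) = r.depth ∧ u i = false) (by
        rw [Finset.mem_filter, Finset.mem_filter, hiff]
        refine and_congr_right fun _ => exists_congr fun i => and_congr_right fun hi => ?_
        rw [hagree i (hi ▸ hlt)])
    refine ⟨Q, fun n X ab ω hω ha hb hpat => ?_⟩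
    have := hQ n X ab ω hω ha hb
    simpa only [GameTerm.eval, hpat _ r hr] using this

/-- A term separating `v` from `w` yields circuits that factor the product of the entries at `v`
and `w`. -/
theorem exists_circuit_of_separating (hL : IsPV L) {F : Set (GameTerm L)} (hF : IsSubtermClosed F)
    (A : GameTerm L → Finset (Fin D → Bool)) {v w : Fin D → Bool} {t : GameTerm L} (ht : t ∈ F)
    (hagree : Agree t.depth v w)
    (hA : ∀ s ∈ F, s.size < t.size → s.depth ≤ t.depth → (v ∈ A s ↔ w ∈ A s))
    (hv : v ∈ A t) (hw : w ∉ A t) :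
    ∃ Q : Polynomial ℕ, ∀ n : ℕ, 3 ≤ n → ∀ ω : (Fin D → Bool) → ℕ,
      (∀ u, ω u ∈ primesOfLength n) → ∃ C : BoolCircuit (2 * n) n, C.size ≤ Q.eval n ∧
        ∀ a ∈ primesOfLength n, ∀ b ∈ primesOfLength n,
          Function.Injective (plant v w ω (a, b)) →
          (∀ s ∈ F, divs (plant v w ω (a, b)) (s.eval (plant v w ω (a, b))) = A s) →
            C.evalNat (a * b) = a := by
  have hvw : v ≠ w := by
    rintro rfl
    exact hw hv
  obtain ⟨Q, hQ⟩ := exists_cost_eval hL hF A hvw t hagree hA t ht le_rfl le_rfl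
  refine ⟨Q + Polynomial.X * (Polynomial.X * 158) + 2, fun n hn ω hω => ?_⟩
  have hlt : ∀ {a}, a ∈ primesOfLength n → a < 2 ^ n := fun ha => by
    simp only [primesOfLength, Finset.mem_filter, Finset.mem_range] at ha
    exact ha.1
  have hprime : ∀ {a}, a ∈ primesOfLength n → a.Prime := fun ha => by
    simp only [primesOfLength, Finset.mem_filter, Finset.mem_range] at ha
    exact ha.2.1
  have hodd : ∀ {a}, a ∈ primesOfLength n → a.Coprime 2 := fun ha => by
    refine (Nat.coprime_primes (hprime ha) Nat.prime_two).2 ?_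
    rintro rfl
    simp only [primesOfLength, Finset.mem_filter, Finset.mem_range] at ha
    have : Nat.size 2 = 2 := by decide
    omega
  let X := {ab : ℕ × ℕ // ab.1 ∈ primesOfLength n ∧ ab.2 ∈ primesOfLength n ∧
    Function.Injective (plant v w ω ab) ∧
    ∀ s ∈ F, divs (plant v w ω ab) (s.eval (plant v w ω ab)) = A s}
  obtain ⟨h1, -⟩ := hQ n X Subtype.val ω (fun u => hlt (hω u)) (fun x => hlt x.2.1)
    (fun x => hlt x.2.2.1) fun x => x.2.2.2.2
  -- The value of `t` is `a * d`. As `n ≥ 3` excludes the prime 2, `d` is odd, and dividing by it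
  -- amounts to multiplying by its inverse `e` modulo `2 ^ n`, which determines `a < 2 ^ n`.
  set d := ∏ u ∈ (A t).erase v, ω u with hd
  have hcop : d.Coprime (2 ^ n) :=
    Nat.Coprime.pow_right _ (Nat.Coprime.prod_left fun u _ => hodd (hω u))
  obtain ⟨e, -, he⟩ := Nat.exists_mul_mod_eq_one_of_coprime hcop
    (Nat.one_lt_two_pow (by omega))
  have hval : ∀ x : X, t.eval (plant v w ω x.1) * e % 2 ^ n = x.1.1 := by
    intro x
    have hne : (A t).Nonempty := ⟨v, hv⟩
    have hpat := x.2.2.2.2 t ht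
    have hdvd : t.eval (plant v w ω x.1) ∣ ∏ u, plant v w ω x.1 u := by
      by_contra h
      rw [divs, if_neg h] at hpat
      exact hne.ne_empty hpat.symm
    have h := prod_divs (plant_mem (fun _ y => y.Prime) (fun u => hprime (hω u)) (hprime x.2.1)
      (hprime x.2.2.1)) x.2.2.2.1 hdvd
    rw [hpat, ← Finset.mul_prod_erase _ _ hv, plant_left hvw] at h
    have h' : ∏ u ∈ (A t).erase v, plant v w ω x.1 u = d := by
      refine Finset.prod_congr rfl fun u hu => plant_of_ne _ _ (Finset.mem_erase.1 hu).1 ?_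
      rintro rfl
      exact hw (Finset.mem_erase.1 hu).2
    rw [h'] at h
    rw [← h, mul_assoc, Nat.mul_mod, he, mul_one, Nat.mod_mod, Nat.mod_eq_of_lt (hlt x.2.1)]
  have h2 := h1.trans (Cost.mul_const_mod (fun x : X => t.eval (plant v w ω x.1)) e n)
  simp only [hval] at h2
  obtain ⟨C, hC, hCe⟩ := h2.exists_circuit (m := 2 * n) (k := n) (fun x => by
    rw [two_mul, pow_add]
    exact Nat.mul_lt_mul'' (hlt x.2.1) (hlt x.2.2.1)) fun x => hlt x.2.1
  exact ⟨C, by simpa using hC, fun a ha b hb hinj hpat => hCe ⟨(a, b), ha, hb, hinj, hpat⟩⟩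

end Factoring

/-! ### Averaging -/

section Averaging

/-- Planting a random pair into a random tuple gives a random tuple. Hence the probability of `E` is
the mean over `ω` of the probability of `E` over pairs, and some `ω` reaches the mean. The
inequality of probabilities is stated with denominators cleared. -/
theorem exists_card_plant_ge {ι : Type} [Fintype ι] [DecidableEq ι] {v w : ι} (hvw : v ≠ w)
    {P : Finset ℕ} (hP : P.Nonempty) (E : (ι → ℕ) → Prop) [DecidablePred E] :
    ∃ ω ∈ Fintype.piFinset fun _ : ι => P,
      ((Fintype.piFinset fun _ : ι => P).filter E).card * (P ×ˢ P).card ≤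
        ((P ×ˢ P).filter fun ab => E (plant v w ω ab)).card *
          (Fintype.piFinset fun _ : ι => P).card := by
  set Ω := Fintype.piFinset fun _ : ι => P with hΩ
  have hΩne : Ω.Nonempty := Fintype.piFinset_nonempty.2 fun _ => hP
  have hmem : ∀ {ω}, ω ∈ Ω → ∀ ab ∈ P ×ˢ P, plant v w ω ab ∈ Ω := by
    intro ω hω ab hab
    rw [hΩ, Fintype.mem_piFinset] at hω ⊢
    rw [Finset.mem_product] at hab
    exact plant_mem (fun _ y => y ∈ P) hω hab.1 hab.2
  have hsum : ∑ ω ∈ Ω, ((P ×ˢ P).filter fun ab => E (plant v w ω ab)).card =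
      (Ω.filter E).card * (P ×ˢ P).card := by
    rw [← Finset.card_product, ← Finset.card_sigma]
    refine Finset.card_bij' (fun x _ => (plant v w x.1 x.2, (x.1 v, x.1 w)))
      (fun y _ => ⟨plant v w y.1 y.2, (y.1 v, y.1 w)⟩) ?_ ?_ ?_ ?_
    · rintro ⟨ω, ab⟩ h
      simp only [Finset.mem_sigma, Finset.mem_filter] at h
      simp only [Finset.mem_product, Finset.mem_filter]
      exact ⟨⟨hmem h.1 _ h.2.1, h.2.2⟩, Fintype.mem_piFinset.1 h.1 v, Fintype.mem_piFinset.1 h.1 w⟩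
    · rintro ⟨ω, ab⟩ h
      rw [Finset.mem_product, Finset.mem_filter] at h
      simp only [Finset.mem_sigma, Finset.mem_filter]
      refine ⟨hmem h.1.1 _ h.2, Finset.mem_product.2
        ⟨Fintype.mem_piFinset.1 h.1.1 v, Fintype.mem_piFinset.1 h.1.1 w⟩, ?_⟩
      rw [plant_plant hvw]
      exact h.1.2
    · rintro ⟨ω, ab⟩ h
      simp only [plant_plant hvw, plant_left hvw, plant_right]
    · rintro ⟨ω, ab⟩ h
      simp only [plant_plant hvw, plant_left hvw, plant_right]
  obtain ⟨ω, hω, h⟩ := Finset.exists_le_of_sum_le hΩne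
    (f := fun _ => (Ω.filter E).card * (P ×ˢ P).card)
    (g := fun ω => ((P ×ˢ P).filter fun ab => E (plant v w ω ab)).card * Ω.card) (by
      rw [Finset.sum_const, ← Finset.sum_mul, hsum, smul_eq_mul, mul_comm])
  exact ⟨ω, hω, h⟩

/-- The pairs of primes of length `n` whose product the circuit factors. -/
def factored {n : ℕ} (C : BoolCircuit (2 * n) n) : Finset (ℕ × ℕ) :=
  {pq ∈ primesOfLength n ×ˢ primesOfLength n |
      C.evalNat (pq.1 * pq.2) = pq.1 ∨ C.evalNat (pq.1 * pq.2) = pq.2}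

theorem lt_two_pow_of_mem {n a : ℕ} (ha : a ∈ primesOfLength n) : a < 2 ^ n := by
  simp only [primesOfLength, Finset.mem_filter, Finset.mem_range] at ha
  exact ha.1

theorem prime_of_mem {n a : ℕ} (ha : a ∈ primesOfLength n) : a.Prime := by
  simp only [primesOfLength, Finset.mem_filter, Finset.mem_range] at ha
  exact ha.2.1

/-- Always answering one fixed prime `p` is right on all pairs `(p, q)`. This handles collisions and
small `n`. -/
theorem exists_const_circuit (n : ℕ) : ∃ C : BoolCircuit (2 * n) n, C.size ≤ 2 ∧
    (primesOfLength n).card ≤ (factored C).card := by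
  rcases (primesOfLength n).eq_empty_or_nonempty with h | ⟨p, hp⟩
  · obtain ⟨C, hC, -⟩ := Cost.exists_circuit (X := Empty) (m := 2 * n) (k := n) (c := 0)
      (N := fun _ => 0) (g := fun _ => 0) .refl (by simp) (by simp)
    exact ⟨C, hC, by simp [h]⟩
  · obtain ⟨C, hC, hCe⟩ := Cost.exists_circuit
      (X := {ab : ℕ × ℕ // ab.1 ∈ primesOfLength n ∧ ab.2 ∈ primesOfLength n})
      (m := 2 * n) (k := n) (c := 0) (N := fun x => x.1.1 * x.1.2) (g := fun _ => p)
      (.of_subset ((obsWires_const _ _).trans Set.subset_union_right))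
      (fun x => by
        rw [two_mul, pow_add]
        exact Nat.mul_lt_mul'' (lt_two_pow_of_mem x.2.1) (lt_two_pow_of_mem x.2.2))
      fun _ => lt_two_pow_of_mem hp
    refine ⟨C, hC, Finset.card_le_card_of_injOn (fun q => (p, q)) (fun q hq => ?_)
      fun q _ r _ h => (Prod.ext_iff.1 h).2⟩
    have hq : q ∈ primesOfLength n := hq
    refine Finset.mem_coe.2 (Finset.mem_filter.2 ⟨Finset.mem_product.2 ⟨hp, hq⟩, .inl ?_⟩)
    exact hCe ⟨(p, q), hp, hq⟩

end Averaging

/-! ### Values of terms that separate nothing -/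

section Nonseparating

variable {L : FirstOrder.Language.{u, v}} {D : ℕ}

open GameTerm

theorem exists_minimal_separating {F : Set (GameTerm L)} (A : GameTerm L → Finset (Fin D → Bool))
    (h : ∃ t ∈ F, ¬ Nonsep t.depth (A t)) :
    ∃ t ∈ F, ∃ v w, Agree t.depth v w ∧ v ∈ A t ∧ w ∉ A t ∧
      ∀ s ∈ F, s.size < t.size → Nonsep s.depth (A s) := by
  obtain ⟨t, ⟨htF, ht⟩, hmin⟩ := (measure (GameTerm.size (L := L))).wf.has_min
    {t | t ∈ F ∧ ¬ Nonsep t.depth (A t)} h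
  have hmin' : ∀ s ∈ F, s.size < t.size → Nonsep s.depth (A s) := fun s hs hlt => by
    by_contra hn
    exact hmin s ⟨hs, hn⟩ hlt
  simp only [Nonsep, not_forall] at ht
  obtain ⟨v, w, hvw, hne⟩ := ht
  by_cases hv : v ∈ A t
  · exact ⟨t, htF, v, w, hvw, hv, fun hw => hne (by simp [hv, hw]), hmin'⟩
  · exact ⟨t, htF, w, v, fun i hi => (hvw i hi).symm, by_contra fun hw => hne (by simp [hv, hw]),
      hv, hmin'⟩

variable [L.Structure ℕ]

/-- The circuit's probability of success is at least the probability that a random tuple is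
injective and has pattern `A`. -/
theorem exists_circuit_of_pattern (hL : IsPV L) {F : Finset (GameTerm L)}
    (hF : IsSubtermClosed (F : Set (GameTerm L))) (A : GameTerm L → Finset (Fin D → Bool))
    (hsep : ∃ t ∈ F, ¬ Nonsep t.depth (A t)) (E : ((Fin D → Bool) → ℕ) → Prop) [DecidablePred E]
    (hE : ∀ p, E p ↔ Function.Injective p ∧ ∀ t ∈ F, divs p (t.eval p) = A t) :
    ∃ Q : Polynomial ℕ, ∀ n, 3 ≤ n → ∃ C : BoolCircuit (2 * n) n, C.size ≤ Q.eval n ∧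
      ((Fintype.piFinset fun _ : Fin D → Bool => primesOfLength n).filter E).card *
        (primesOfLength n ×ˢ primesOfLength n).card ≤
      (factored C).card * (Fintype.piFinset fun _ : Fin D → Bool => primesOfLength n).card := by
  obtain ⟨t, ht, v, w, hagree, hv, hw, hmin⟩ := exists_minimal_separating (F := (F : Set _)) A hsep
  have hvw : v ≠ w := by
    rintro rfl
    exact hw hv
  obtain ⟨Q, hQ⟩ := exists_circuit_of_separating hL hF A ht hagree
    (fun s hs hlt hd => hmin s hs hlt v w fun i hi => hagree i (hi.trans_le hd)) hv hw
  refine ⟨Q + 2, fun n hn => ?_⟩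
  rcases (primesOfLength n).eq_empty_or_nonempty with h | h
  · obtain ⟨C, hC, -⟩ := exists_const_circuit n
    exact ⟨C, hC.trans (by simp), by simp [h]⟩
  obtain ⟨ω, hω, hle⟩ := exists_card_plant_ge hvw h E
  obtain ⟨C, hC, hCe⟩ := hQ n hn ω (Fintype.mem_piFinset.1 hω)
  refine ⟨C, hC.trans (by simp), hle.trans (Nat.mul_le_mul_right _ (Finset.card_le_card ?_))⟩
  intro ab hab
  rw [Finset.mem_filter, Finset.mem_product, hE] at hab
  exact Finset.mem_filter.2 ⟨Finset.mem_product.2 hab.1,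
    .inl (hCe _ hab.1.1 _ hab.1.2 hab.2.1 hab.2.2)⟩

/-- Two independent primes coincide with probability one over the number of primes, which a constant
circuit already achieves. -/
theorem exists_circuit_of_collision {ι : Type} [Fintype ι] [DecidableEq ι] {v w : ι} (hvw : v ≠ w)
    (E : (ι → ℕ) → Prop) [DecidablePred E] (hE : ∀ p, E p ↔ p v = p w) (n : ℕ) :
    ∃ C : BoolCircuit (2 * n) n, C.size ≤ 2 ∧
      ((Fintype.piFinset fun _ : ι => primesOfLength n).filter E).card *
        (primesOfLength n ×ˢ primesOfLength n).card ≤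
      (factored C).card * (Fintype.piFinset fun _ : ι => primesOfLength n).card := by
  obtain ⟨C, hC, hle⟩ := exists_const_circuit n
  refine ⟨C, hC, ?_⟩
  rcases (primesOfLength n).eq_empty_or_nonempty with h | h
  · simp [h]
  obtain ⟨ω, -, h⟩ := exists_card_plant_ge hvw h E
  refine h.trans (Nat.mul_le_mul_right _ (le_trans ?_ hle))
  refine Finset.card_le_card_of_injOn Prod.fst (fun ab hab => ?_) fun ab hab cd hcd h => ?_
  · exact (Finset.mem_product.1 (Finset.mem_filter.1 hab).1).1
  · have h1 := (Finset.mem_filter.1 hab).2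
    have h2 := (Finset.mem_filter.1 hcd).2
    rw [hE, plant_left hvw, plant_right] at h1 h2
    exact Prod.ext h (h1.symm.trans (h.trans h2))

/-- If factoring is hard, then no finite set of terms can separate the factors of every product of
primes of the same length. -/
theorem exists_nonseparating (hard : FactoringHard) (hL : IsPV L) {F : Finset (GameTerm L)}
    (hF : IsSubtermClosed (F : Set (GameTerm L))) (D : ℕ) :
    ∃ p : (Fin D → Bool) → ℕ, (∀ u, (p u).Prime) ∧ Function.Injective p ∧
      ∀ t ∈ F, Nonsep t.depth (divs p (t.eval p)) := by
  classical
  by_contra hcon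
  push Not at hcon
  -- What can happen to a tuple: a pattern of divisibilities or a collision at two given points. The
  -- number of cases does not depend on `n`.
  let κ := (F → Finset (Fin D → Bool)) ⊕
    {vw : (Fin D → Bool) × (Fin D → Bool) // vw.1 ≠ vw.2}
  let E : κ → ((Fin D → Bool) → ℕ) → Prop := fun i p => i.elim
    (fun A => Function.Injective p ∧ ∀ t : F, divs p (t.1.eval p) = A t)
    fun vw => p vw.1.1 = p vw.1.2
  have hcover : ∀ p, ∃ i, E i p := by
    intro p
    by_cases hp : Function.Injective p
    · exact ⟨.inl fun t => divs p (t.1.eval p), hp, fun _ => rfl⟩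
    · simp only [Function.Injective, not_forall] at hp
      obtain ⟨v, w, h, hne⟩ := hp
      exact ⟨.inr ⟨(v, w), hne⟩, h⟩
  have hcirc : ∀ i : κ, ∃ Q : Polynomial ℕ, ∀ n, 3 ≤ n → ∃ C : BoolCircuit (2 * n) n,
      C.size ≤ Q.eval n ∧
      ((Fintype.piFinset fun _ : Fin D → Bool => primesOfLength n).filter (E i)).card *
        (primesOfLength n ×ˢ primesOfLength n).card ≤
      (factored C).card * (Fintype.piFinset fun _ : Fin D → Bool => primesOfLength n).card := by
    rintro (A | ⟨⟨v, w⟩, hvw⟩)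
    · let A' : GameTerm L → Finset (Fin D → Bool) := fun t => if h : t ∈ F then A ⟨t, h⟩ else ∅
      have hA' : ∀ p, E (.inl A) p ↔ Function.Injective p ∧ ∀ t ∈ F, divs p (t.eval p) = A' t := by
        intro p
        refine and_congr_right fun _ => ?_
        rw [Subtype.forall]
        exact forall₂_congr fun t ht => by simp [A', ht]
      by_cases hsep : ∃ t ∈ F, ¬ Nonsep t.depth (A' t)
      · exact exists_circuit_of_pattern hL hF A' hsep _ hA'
      -- By the assumption `hcon`, a pattern without a separating term never occurs, so any circuit
      -- will do.
      · refine ⟨2, fun n _ => ?_⟩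
        obtain ⟨C, hC, -⟩ := exists_const_circuit n
        refine ⟨C, by simpa using hC, ?_⟩
        rw [Finset.filter_false_of_mem, Finset.card_empty, zero_mul]
        · exact Nat.zero_le _
        intro p hp h
        rw [hA'] at h
        obtain ⟨t, ht, hn⟩ := hcon p (fun u => prime_of_mem (Fintype.mem_piFinset.1 hp u)) h.1
        exact hsep ⟨t, ht, h.2 t ht ▸ hn⟩
    · refine ⟨2, fun n _ => ?_⟩
      obtain ⟨C, hC, h⟩ := exists_circuit_of_collision hvw (E (.inr ⟨(v, w), hvw⟩))
        (fun _ => Iff.rfl) n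
      exact ⟨C, by simpa using hC, h⟩
  choose Q hQ using hcirc
  -- For `n ≥ 3` some case has probability at least `1 / card κ`. For `n < 3` there are at most 4
  -- primes, which explains the summand 4.
  have hall : ∀ n, ∃ C : BoolCircuit (2 * n) n, C.size ≤ (∑ i, Q i + 2).eval n ∧
      (primesOfLength n ×ˢ primesOfLength n).card ≤ (factored C).card * (Fintype.card κ + 4) := by
    intro n
    obtain ⟨C₀, hC₀, hle⟩ := exists_const_circuit n
    have hsize : C₀.size ≤ (∑ i, Q i + 2).eval n := hC₀.trans (by simp)
    rcases (primesOfLength n).eq_empty_or_nonempty with h | h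
    · exact ⟨C₀, hsize, by simp [h]⟩
    rcases lt_or_ge n 3 with hn | hn
    · refine ⟨C₀, hsize, ?_⟩
      rw [Finset.card_product]
      refine Nat.mul_le_mul hle ?_
      have h1 : (primesOfLength n).card ≤ 2 ^ n :=
        (Finset.card_filter_le _ _).trans (by simp)
      have h2 : 2 ^ n ≤ 2 ^ 2 := Nat.pow_le_pow_right two_pos (by omega)
      omega
    · set Ω := Fintype.piFinset fun _ : Fin D → Bool => primesOfLength n with hΩ
      have hΩpos : 0 < Ω.card := Finset.card_pos.2 (Fintype.piFinset_nonempty.2 fun _ => h)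
      have hκ : Nonempty κ := ⟨(hcover fun _ => 0).choose⟩
      have hunion : Ω.card ≤ ∑ i, (Ω.filter (E i)).card := by
        refine le_trans (Finset.card_le_card ?_) Finset.card_biUnion_le
        intro p hp
        obtain ⟨i, hi⟩ := hcover p
        exact Finset.mem_biUnion.2 ⟨i, Finset.mem_univ _, Finset.mem_filter.2 ⟨hp, hi⟩⟩
      obtain ⟨i, -, hi⟩ := Finset.exists_le_of_sum_le (s := (Finset.univ : Finset κ))
        Finset.univ_nonempty (f := fun _ => Ω.card)
        (g := fun i => (Ω.filter (E i)).card * Fintype.card κ) (by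
          rw [← Finset.sum_mul, Finset.sum_const, smul_eq_mul, Finset.card_univ, mul_comm]
          exact Nat.mul_le_mul_right _ hunion)
      obtain ⟨C, hC, hCle⟩ := hQ i n hn
      refine ⟨C, hC.trans ?_, ?_⟩
      · rw [Polynomial.eval_add, Polynomial.eval_finsetSum]
        exact (Finset.single_le_sum (f := fun i => (Q i).eval n) (fun _ _ => Nat.zero_le _)
          (Finset.mem_univ i)).trans (Nat.le_add_right _ _)
      · refine Nat.le_of_mul_le_mul_left ?_ hΩpos
        calc Ω.card * (primesOfLength n ×ˢ primesOfLength n).card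
            ≤ (Ω.filter (E i)).card * Fintype.card κ *
              (primesOfLength n ×ˢ primesOfLength n).card := Nat.mul_le_mul_right _ hi
          _ = (Ω.filter (E i)).card * (primesOfLength n ×ˢ primesOfLength n).card *
              Fintype.card κ := by ring
          _ ≤ (factored C).card * Ω.card * Fintype.card κ := Nat.mul_le_mul_right _ hCle
          _ ≤ (factored C).card * Ω.card * (Fintype.card κ + 4) :=
              Nat.mul_le_mul_left _ (Nat.le_add_right _ _)
          _ = _ := by ring
  choose C hC hle using hall
  obtain ⟨n, hn, hlt⟩ := hard (1 / (Fintype.card κ + 4)) (by positivity) C ⟨_, hC⟩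
  have hpos : 0 < (primesOfLength n ×ˢ primesOfLength n).card :=
    Finset.card_pos.2 (hn.product hn)
  have h1 : ((factored (C n)).card : ℝ) / ((primesOfLength n ×ˢ primesOfLength n).card : ℕ) <
      1 / (Fintype.card κ + 4) := hlt
  rw [div_lt_div_iff₀ (by exact_mod_cast hpos) (by positivity), one_mul] at h1
  have h2 : ((primesOfLength n ×ˢ primesOfLength n).card : ℝ) ≤
      (factored (C n)).card * (Fintype.card κ + 4) := by exact_mod_cast hle n
  linarith

end Nonseparating

/-! ### A model of the true universal theory without prime factors -/

section Model

open FirstOrder.Language FirstOrder.Language.Structure Filter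

variable {L : FirstOrder.Language.{u, v}} [L.Structure ℕ]

theorem realize_primeFactor_iff (S : ArithSymbols L) (M : Type*) [L.Structure M] :
    M ⊨ primeFactor S ↔ ∀ x : M, funMap S.le ![(S.two : M), x] = S.one →
      ∃ y : M, funMap S.le ![y, x] = S.one ∧ ∀ z : M, funMap S.le ![z, y] = S.one →
        funMap S.le ![(S.two : M), y] = S.one ∧ funMap S.dvd ![y, x] = S.one ∧
          (funMap S.dvd ![z, y] = S.one → z = S.one ∨ z = y) := by
  simp [primeFactor, primeFactor₀, ArithSymbols.leF, ArithSymbols.dvdF, Sentence.Realize,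
    Formula.Realize, Fin.snoc]

theorem TPV_isUniversal : (TPV L).IsUniversal := ⟨fun _ h => h.1⟩

theorem ultrapower_models_TPV {I : Type*} (U : Ultrafilter I) :
    (U : Filter I).Product (fun _ => ℕ) ⊨ TPV L :=
  ⟨fun φ hφ => (Ultraproduct.sentence_realize φ).2 (.of_forall fun _ => hφ.2)⟩

/-- Interpretations of the terms in `ℕ`, indexed by a set with an ultrafilter, give a model of the
true universal theory, consisting of the limits of the values of terms. -/
theorem exists_limit_model {I : Type u} (U : Ultrafilter I) (val : GameTerm L → I → ℕ)
    (hval : ∀ (k : ℕ) (f : L.Functions k) (a : Fin k → GameTerm L) (i : I),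
      val (.app f a) i = funMap f fun j => val (a j) i) :
    ∃ (M : Type u) (_ : L.Structure M) (e : GameTerm L → M), M ⊨ TPV L ∧ Function.Surjective e ∧
      (∀ (k : ℕ) (f : L.Functions k) (a : Fin k → GameTerm L),
        funMap f (fun j => e (a j)) = e (.app f a)) ∧
      ∀ s t, e s = e t ↔ ∀ᶠ i in U, val s i = val t i := by
  let V := (U : Filter I).Product fun _ : I => ℕ
  let cl : GameTerm L → V := fun t => (val t : V)
  have hcl : ∀ (k : ℕ) (f : L.Functions k) (a : Fin k → GameTerm L),
      funMap f (fun j => cl (a j)) = cl (.app f a) := fun k f a => by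
    refine (Ultraproduct.funMap_cast f fun j => val (a j)).trans ?_
    exact congrArg (Quotient.mk _) (funext fun i => (hval k f a i).symm)
  let N : L.Substructure V :=
    { carrier := Set.range cl
      fun_mem := fun {k} f x hx => by
        choose a ha using hx
        exact ⟨.app f a, by rw [← hcl]; exact congrArg _ (funext ha)⟩ }
  -- Universality lets the substructure `N` inherit the theory from the ultrapower by instance
  -- resolution.
  have := TPV_isUniversal (L := L)
  have : V ⊨ TPV L := ultrapower_models_TPV U
  refine ⟨N, inferInstance, fun t => ⟨cl t, t, rfl⟩, inferInstance, ?_, ?_, fun s t => ?_⟩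
  · rintro ⟨_, t, rfl⟩
    exact ⟨t, rfl⟩
  · exact fun k f a => Subtype.ext (hcl k f a)
  · exact Subtype.ext_iff.trans Quotient.eq''

theorem exists_model_not_primeFactor (hard : FactoringHard) (hL : IsPV L) (S : ArithSymbols L) :
    ∃ (M : Type u) (_ : L.Structure M) (_ : Nonempty M), M ⊨ TPV L ∧ ¬ M ⊨ primeFactor S := by
  classical
  have hex : ∀ F : Finset (GameTerm L), ∃ (D : ℕ) (p : (Fin D → Bool) → ℕ),
      (∀ u, (p u).Prime) ∧ Function.Injective p ∧
        ∀ t ∈ F, t.depth < D ∧ Nonsep t.depth (divs p (t.eval p)) := by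
    intro F
    obtain ⟨G, hG, hFG⟩ := exists_subtermClosed_superset F
    -- One dimension more than the largest depth, so that the coordinate used by `cex t` exists for
    -- every `t ∈ F`.
    obtain ⟨p, hp, hinj, hsep⟩ := exists_nonseparating hard hL hG (F.sup GameTerm.depth + 1)
    exact ⟨_, p, hp, hinj, fun t ht =>
      ⟨Nat.lt_succ_of_le (Finset.le_sup (f := GameTerm.depth) ht), hsep t (hFG ht)⟩⟩
  choose D p hp hinj hsep using hex
  -- Every term lies in `U`-almost all finite sets `F`, so the guarantees for members of `F` hold in
  -- the limit for all terms.
  let U : Ultrafilter (Finset (GameTerm L)) := Ultrafilter.of atTop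
  have hU : ∀ t : GameTerm L, ∀ᶠ F : Finset (GameTerm L) in U, t ∈ F := fun t =>
    Ultrafilter.of_le atTop ((eventually_ge_atTop {t}).mono fun F hF =>
      Finset.singleton_subset_iff.1 hF)
  obtain ⟨M, _, e, hM, hsurj, happ, heq⟩ := exists_limit_model U
    (fun (t : GameTerm L) F => t.eval (p F))
    fun k f a F => rfl
  refine ⟨M, inferInstance, ⟨e .var⟩, hM, fun h => ?_⟩
  rw [realize_primeFactor_iff] at h
  have hconst : ∀ c : L.Constants, (c : M) = e (.app c Fin.elim0) := fun c => by
    rw [← happ]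
    exact congrArg (funMap c) (Subsingleton.elim (α := Fin 0 → M) _ _)
  have hconst' : ∀ (c : L.Constants) (F : Finset (GameTerm L)),
      (GameTerm.app c Fin.elim0).eval (p F) = (c : ℕ) := fun c F =>
    congrArg (funMap c) (Subsingleton.elim (α := Fin 0 → ℕ) _ _)
  have hrel : ∀ (f : L.Functions 2) (s t : GameTerm L), funMap f ![e s, e t] = (S.one : M) ↔
      ∀ᶠ F in U, funMap f ![s.eval (p F), t.eval (p F)] = (1 : ℕ) := fun f s t => by
    have : (![e s, e t] : Fin 2 → M) = fun j => e (![s, t] j) := by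
      funext j; fin_cases j <;> rfl
    rw [this, happ, hconst, heq]
    refine eventually_congr (.of_forall fun F => ?_)
    rw [hconst', S.one_eq, GameTerm.eval]
    have : (fun j => (![s, t] j).eval (p F)) = ![s.eval (p F), t.eval (p F)] := by
      funext j; fin_cases j <;> rfl
    rw [this]
  have hle : ∀ s t, funMap S.le ![e s, e t] = (S.one : M) ↔
      ∀ᶠ F in U, s.eval (p F) ≤ t.eval (p F) := fun s t =>
    (hrel S.le s t).trans (eventually_congr (.of_forall fun F => S.le_iff _ _))
  have hdvd : ∀ s t, funMap S.dvd ![e s, e t] = (S.one : M) ↔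
      ∀ᶠ F in U, s.eval (p F) ∣ t.eval (p F) := fun s t =>
    (hrel S.dvd s t).trans (eventually_congr (.of_forall fun F => S.dvd_iff _ _))
  have hpos : ∀ F, 0 < GameTerm.eval (p F) (.var : GameTerm L) := fun F =>
    Finset.prod_pos fun u _ => (hp F u).pos
  obtain ⟨y, hy, hz⟩ := h (e .var) (by
    rw [hconst, hle]
    refine .of_forall fun F => ?_
    rw [hconst', S.two_eq]
    exact (hp F fun _ => false).two_le.trans
      (Nat.le_of_dvd (hpos F) (Finset.dvd_prod_of_mem _ (Finset.mem_univ _))))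
  obtain ⟨t, rfl⟩ := hsurj y
  -- The conditions `2 ≤ y` and `y ∣ x` stand under the quantifier over `z`; the instance `z = y`
  -- releases them.
  obtain ⟨h2, hyx, -⟩ := hz (e t) ((hle t t).2 (.of_forall fun _ => le_rfl))
  rw [hconst, hle] at h2
  rw [hdvd] at hyx
  have key : ∀ᶠ F in U, (GameTerm.cex t).eval (p F) ∣ t.eval (p F) ∧
      (GameTerm.cex t).eval (p F) ≠ 1 ∧ (GameTerm.cex t).eval (p F) ≠ t.eval (p F) ∧
      (GameTerm.cex t).eval (p F) ≤ t.eval (p F) := by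
    filter_upwards [h2, hyx, hU t] with F h2 hyx ht
    rw [hconst', S.two_eq] at h2
    obtain ⟨g1, g2, g3⟩ := cex_refutes (hp F) (hinj F) t (hsep F t ht).1 (hsep F t ht).2 h2 hyx
    exact ⟨g1, g2, g3, Nat.le_of_dvd (by omega) g1⟩
  obtain ⟨-, -, himp⟩ := hz (e (.cex t)) ((hle _ _).2 (key.mono fun F h => h.2.2.2))
  rcases himp ((hdvd _ _).2 (key.mono fun F h => h.1)) with h1 | h1
  · rw [hconst, heq] at h1
    obtain ⟨F, hF, hF'⟩ := (h1.and key).exists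
    rw [hconst', S.one_eq] at hF
    exact hF'.2.1 hF
  · rw [heq] at h1
    obtain ⟨F, hF, hF'⟩ := (h1.and key).exists
    exact hF'.2.2.1 hF

end Model

end PVFactor

/-! ### Unprovability of PrimeFactor -/

theorem corollary3p10 (hard : FactoringHard) (L : FirstOrder.Language.{u, v})
    [L.Structure ℕ] (hL : IsPV L) (S : ArithSymbols L) :
    ¬ (TPV L ⊨ᵇ primeFactor S) ∧
      ∀ T : L.Theory, (∀ ψ ∈ T, TPV L ⊨ᵇ ψ) → ¬ (T ⊨ᵇ primeFactor S) := by
  have h : ¬ (TPV L ⊨ᵇ primeFactor S) := by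
    intro h
    obtain ⟨M, _, _, _, hn⟩ := exists_model_not_primeFactor hard hL S
    exact hn (h.realize_sentence M)
  exact ⟨h, fun T hT h' => h (FirstOrder.Language.Theory.models_of_models_theory hT h')⟩
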